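/- Let $n\ge 2$, let $a_1,\dots,a_n\in\mathbb{C}$ satisfy $0<|a_1|=\cdots=|a_n|<1$, let $\phi(z_1,\dots,z_n)=(a_1z_1,\dots,a_nz_n)$, and let $M^n=(\mathbb{C}^n\setminus\{0\})/\langle\phi\rangle$ be the standard isosceles Hopf manifold, with the Hermitian metric $g$ whose Kähler form is $\omega=\sqrt{-1}\,\partial\overline{\partial}|z|^2/|z|^2$. Let $\nabla$, $\nabla^c$, $\nabla^b$ be the Levi-Civita, Chern and Bismut connections of $g$. (These exist; the Chern connection is the connection preserving $g$ and $J$ whose torsion has no $(1,1)$-part, and the Bismut connection is the connection preserving $g$ and $J$ whose torsion is totally skew-symmetric.) For real $r,s$ put $$D^r=\tfrac{1+r}{2}\nabla^c+\tfrac{1-r}{2}\nabla^b,\qquad D^r_s=(1-s)D^r+s\nabla,$$ $$\Omega=\{(r,s)\in\mathbb{R}^2: s\ne 1\}\cup\{(0,1)\},\qquad \Gamma=\{(r,s)\in\mathbb{R}^2:(1-r+rs)^2+s^2=4\}\subset\Omega.$$ For a connection $D$ with curvature $R^D_{xy}z=D_xD_yz-D_yD_xz-D_{[x,y]}z$, its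 holomorphic sectional curvature is the function $$H^D(x)=-\frac{\langle R^D_{x,Jx}x,\,Jx\rangle}{|x|^2|Jx|^2-\langle x,Jx\rangle^2}$$ on nonzero real tangent vectors $x$; $D$ is flat if $R^D=0$ identically. Then: 1. if $(r,s)\in\Omega\setminus\Gamma$, the holomorphic sectional curvature of $D^r_s$ is not constant on $M^n$; 2. if $(r,s)\in\Gamma$, the holomorphic sectional curvature of $D^r_s$ vanishes identically; 3. for $(r,s)\in\Omega$, the connection $D^r_s$ is flat if and only if $n=2$ and $(r,s)$ is one of $(-1,0)$, $(-1,2)$, $(\tfrac13,-2)$, that is, $D^r_s$ is $\nabla^b=D^{-1}_0$, $\nabla^+:=D^{-1}_2$ or $\nabla^-:=D^{1/3}_{-2}$. -/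

import Mathlib

open Bundle Manifold ContDiff

noncomputable section HopfDefinitions

section RiemannianGeometry

variable {E : Type*} [NormedAddCommGroup E] [NormedSpace ℝ E] [FiniteDimensional ℝ E]
  {H : Type*} [TopologicalSpace H] {I : ModelWithCorners ℝ E H}
  {M : Type*} [TopologicalSpace M] [ChartedSpace H M] [IsManifold I ∞ M]

/-- A connection on (the tangent bundle of) the smooth manifold `M`.
In Mathlib's notation `D Y x v` is `(D_v Y)(x)`. -/
abbrev AffineConnection (I : ModelWithCorners ℝ E H) (M : Type*) [TopologicalSpace M]
    [ChartedSpace H M] [IsManifold I ∞ M] : Type _ :=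
  CovariantDerivative I E (fun x : M => TangentSpace I x)

/-- A smooth Riemannian metric on the smooth manifold `M`. -/
abbrev SmoothMetric (I : ModelWithCorners ℝ E H) (M : Type*) [TopologicalSpace M]
    [ChartedSpace H M] [IsManifold I ∞ M] : Type _ :=
  ContMDiffRiemannianMetric I ∞ E (fun x : M => TangentSpace I x)

namespace AffineConnection

/-- The vector field `X` is differentiable at `x`. -/
def DiffFieldAt (X : Π y : M, TangentSpace I y) (x : M) : Prop :=
  MDifferentiableAt I I.tangent (fun y => (⟨y, X y⟩ : TangentBundle I M)) x

/-- `D g = 0`: for all differentiable `X`, `Y` and every tangent vector `v`,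
`v⟨X, Y⟩ = ⟨D_v X, Y⟩ + ⟨X, D_v Y⟩`. -/
def IsMetric (D : AffineConnection I M) (g : SmoothMetric I M) : Prop :=
  ∀ (x : M) (X Y : Π y : M, TangentSpace I y), DiffFieldAt X x → DiffFieldAt Y x →
    ∀ v : TangentSpace I x,
      mfderiv I 𝓘(ℝ, ℝ) (fun y => g.inner y (X y) (Y y)) x v
        = g.inner x (D X x v) (Y x) + g.inner x (X x) (D Y x v)

/-- `D J = 0` for a field `J` of endomorphisms of the tangent spaces: `D_v (J X) = J (D_v X)`. -/
def PreservesJ (D : AffineConnection I M)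
    (J : Π x : M, TangentSpace I x →L[ℝ] TangentSpace I x) : Prop :=
  ∀ (x : M) (X : Π y : M, TangentSpace I y), DiffFieldAt X x →
    ∀ v : TangentSpace I x, D (fun y => J y (X y)) x v = J x (D X x v)

/-- `D` is the Levi-Civita connection of `g`: metric and torsion-free. -/
def IsLeviCivita (D : AffineConnection I M) (g : SmoothMetric I M) : Prop :=
  D.IsMetric g ∧ ∀ (x : M) (u v : TangentSpace I x), D.torsion x u v = 0

/-- `D` is the Chern connection of the Hermitian structure `(g, J)`: `D g = 0`, `D J = 0`, and the
`(1,1)`-part of the torsion vanishes, i.e. `T(Ju, Jv) = - T(u, v)`. -/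
def IsChern (D : AffineConnection I M) (g : SmoothMetric I M)
    (J : Π x : M, TangentSpace I x →L[ℝ] TangentSpace I x) : Prop :=
  D.IsMetric g ∧ D.PreservesJ J ∧
    ∀ (x : M) (u v : TangentSpace I x), D.torsion x (J x u) (J x v) = - D.torsion x u v

/-- `D` is the Bismut connection of the Hermitian structure `(g, J)`: `D g = 0`, `D J = 0`, and the
torsion `⟨T(u, v), w⟩` (always skew in `u, v`) is totally skew-symmetric. -/
def IsBismut (D : AffineConnection I M) (g : SmoothMetric I M)
    (J : Π x : M, TangentSpace I x →L[ℝ] TangentSpace I x) : Prop :=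
  D.IsMetric g ∧ D.PreservesJ J ∧
    ∀ (x : M) (u v w : TangentSpace I x),
      g.inner x (D.torsion x u v) w = - g.inner x (D.torsion x u w) v

/-- The Gauduchon connection `D^r = (1+r)/2 ∇^c + (1-r)/2 ∇^b`, where `C = ∇^c`, `B = ∇^b`. -/
def gauduchon (C B : AffineConnection I M) (r : ℝ) : AffineConnection I M :=
  CovariantDerivative.affineCombination C B (fun _ => (1 + r) / 2)

/-- The canonical metric connection `D^r_s = (1-s) D^r + s ∇`, where `L = ∇` is the Levi-Civita
connection, `C = ∇^c` and `B = ∇^b`. -/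
def canonical (L C B : AffineConnection I M) (r s : ℝ) : AffineConnection I M :=
  CovariantDerivative.affineCombination (gauduchon C B r) L (fun _ => 1 - s)

lemma gauduchon_apply (C B : AffineConnection I M) (r : ℝ) (Y : Π y : M, TangentSpace I y)
    (x : M) (v : TangentSpace I x) :
    gauduchon C B r Y x v = ((1 + r) / 2) • C Y x v + ((1 - r) / 2) • B Y x v := by
  change ((1 + r) / 2) • C Y x v + (1 - (1 + r) / 2) • B Y x v = _
  congr 2
  ring

lemma canonical_apply (L C B : AffineConnection I M) (r s : ℝ) (Y : Π y : M, TangentSpace I y)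
    (x : M) (v : TangentSpace I x) :
    canonical L C B r s Y x v = (1 - s) • gauduchon C B r Y x v + s • L Y x v := by
  change (1 - s) • gauduchon C B r Y x v + (1 - (1 - s)) • L Y x v = _
  congr 2
  ring

/-- `D_X D_Y Z - D_Y D_X Z - D_{[X,Y]} Z` for vector fields `X`, `Y`, `Z`. -/
def curvatureField (D : AffineConnection I M) (X Y Z : Π x : M, TangentSpace I x) (x : M) :
    TangentSpace I x :=
  D (fun y => D Z y (Y y)) x (X x) - D (fun y => D Z y (X y)) x (Y x)
    - D Z x (VectorField.mlieBracket I X Y x)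

/-- The curvature tensor `R_{uv} w` at `x`: the value at `x` of `curvatureField` on vector fields
extending `u`, `v`, `w` smoothly around `x` (the expression is tensorial; `FiberBundle.extend`
takes the fields with constant coefficients in the preferred chart at `x`). -/
def curvature (D : AffineConnection I M) (x : M) (u v w : TangentSpace I x) : TangentSpace I x :=
  curvatureField D (FiberBundle.extend E u) (FiberBundle.extend E v) (FiberBundle.extend E w) x

/-- `R(u, v, w, z) = ⟨R_{uv} w, z⟩`. -/
def curvature4 (D : AffineConnection I M) (g : SmoothMetric I M) (x : M)
    (u v w z : TangentSpace I x) : ℝ :=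
  g.inner x (D.curvature x u v w) z

/-- `D` is flat: its curvature tensor vanishes identically. -/
def IsFlat (D : AffineConnection I M) : Prop :=
  ∀ (x : M) (u v w : TangentSpace I x), D.curvature x u v w = 0

/-- The sectional curvature `- R(u, v, u, v) / |u ∧ v|²` of the plane spanned by `u`, `v`. -/
def sectionalCurvature (D : AffineConnection I M) (g : SmoothMetric I M) (x : M)
    (u v : TangentSpace I x) : ℝ :=
  - D.curvature4 g x u v u v / (g.inner x u u * g.inner x v v - g.inner x u v ^ 2)

/-- The holomorphic sectional curvature of `D` is identically equal to `c`: the sectional curvature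
of every `J`-invariant plane `span {u, Ju}`, `u ≠ 0`, is `c`. -/
def HasConstantHSC (D : AffineConnection I M) (g : SmoothMetric I M)
    (J : Π x : M, TangentSpace I x →L[ℝ] TangentSpace I x) (c : ℝ) : Prop :=
  ∀ (x : M) (u : TangentSpace I x), u ≠ 0 → D.sectionalCurvature g x u (J x u) = c

end AffineConnection

end RiemannianGeometry

/-- The parameter domain `Ω = {s ≠ 1} ∪ {(0, 1)}` of pairs `(r, s)`. -/
def canonicalDomain : Set (ℝ × ℝ) := {p | p.2 ≠ 1} ∪ {(0, 1)}

/-- The Chen-Nie curve `Γ = {(r, s) | (1 - r + r s)² + s² = 4}`. -/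
def chenNieCurve : Set (ℝ × ℝ) := {p | (1 - p.1 + p.1 * p.2) ^ 2 + p.2 ^ 2 = 4}

section HopfManifold

variable (n : ℕ)

/-- `ℂⁿ` with its standard Hermitian inner product. -/
abbrev Cn : Type := EuclideanSpace ℂ (Fin n)

/-- `ℂⁿ ∖ {0}`, as an open subset of `ℂⁿ`. -/
def PuncturedSpace : TopologicalSpace.Opens (Cn n) := ⟨{0}ᶜ, isOpen_compl_singleton⟩

/-- Constants `a₁, …, aₙ` with `0 < |a₁| = ⋯ = |aₙ| < 1`; `ρ` is the common modulus. -/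
structure HopfMultiplier where
  a : Fin n → ℂ
  ρ : ℝ
  pos : 0 < ρ
  lt1 : ρ < 1
  norm_eq : ∀ i, ‖a i‖ = ρ

variable {n}
namespace HopfMultiplier
variable (A : HopfMultiplier n)

lemma ne_zero (i) : A.a i ≠ 0 := by
  have := A.norm_eq i
  intro h; rw [h, norm_zero] at this; exact A.pos.ne this

/-- The linear automorphism `(z₁, …, zₙ) ↦ (a₁ z₁, …, aₙ zₙ)` of `ℂⁿ`. -/
def lin (A : HopfMultiplier n) : Cn n ≃L[ℂ] Cn n :=
  LinearEquiv.toContinuousLinearEquiv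
    { toFun := fun z => WithLp.toLp 2 fun i => A.a i * z i
      invFun := fun z => WithLp.toLp 2 fun i => (A.a i)⁻¹ * z i
      map_add' := fun z w => by ext i; simp [mul_add]
      map_smul' := fun c z => by ext i; simp; ring
      left_inv := fun z => by ext i; simp [A.ne_zero i]
      right_inv := fun z => by ext i; simp [A.ne_zero i] }

/-- The automorphism `φ(z₁, …, zₙ) = (a₁ z₁, …, aₙ zₙ)` of `ℂⁿ ∖ {0}`. -/
def phi : Equiv.Perm (PuncturedSpace n) :=
  A.lin.toEquiv.subtypeEquiv (fun z => by
    change z ≠ 0 ↔ A.lin z ≠ 0; simp)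

/-- The Hopf manifold `(ℂⁿ ∖ {0}) / ⟨φ⟩`, the orbit space of the cyclic group generated by `φ`. -/
def HopfManifold : Type := MulAction.orbitRel.Quotient (Subgroup.zpowers A.phi) (PuncturedSpace n)


lemma equiv_mul_apply (e f : Cn n ≃L[ℂ] Cn n) (z : Cn n) : (e * f) z = e (f z) := rfl

lemma norm_lin (z : Cn n) : ‖A.lin z‖ = A.ρ * ‖z‖ := by
  have h : ∀ w : Cn n, ‖w‖ ^ 2 = ∑ i, ‖w i‖ ^ 2 := fun w => EuclideanSpace.norm_sq_eq w
  have h2 : ‖A.lin z‖ ^ 2 = (A.ρ * ‖z‖) ^ 2 := by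
    rw [mul_pow, h, h, Finset.mul_sum]
    refine Finset.sum_congr rfl fun i _ => ?_
    change ‖A.a i * z i‖ ^ 2 = _
    rw [norm_mul, A.norm_eq, mul_pow]
  exact (sq_eq_sq₀ (norm_nonneg _) (mul_nonneg A.pos.le (norm_nonneg _))).1 h2

lemma norm_lin_zpow (k : ℤ) (z : Cn n) : ‖(A.lin ^ k) z‖ = A.ρ ^ k * ‖z‖ := by
  have hρ := A.pos.ne'
  induction k using Int.induction_on generalizing z with
  | zero => rw [zpow_zero, zpow_zero, one_mul]; rfl
  | succ k ih => rw [zpow_add_one, equiv_mul_apply, ih, norm_lin, zpow_add_one₀ hρ]; ring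
  | pred k ih =>
    have h : ‖(A.lin ^ (-(k:ℤ) - 1)) (A.lin (A.lin.symm z))‖ = A.ρ ^ (-(k:ℤ)) * ‖A.lin.symm z‖ := by
      rw [← ih, ← equiv_mul_apply, ← zpow_add_one, sub_add_cancel]
    have h' : ‖z‖ = A.ρ * ‖A.lin.symm z‖ := by rw [← norm_lin]; simp
    rw [A.lin.apply_symm_apply] at h
    rw [h, h', zpow_sub_one₀ hρ]; field_simp

lemma phi_zpow_coe (k : ℤ) (u : PuncturedSpace n) : (((A.phi ^ k) u : PuncturedSpace n) : Cn n) = (A.lin ^ k) (u : Cn n) := by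
  induction k using Int.induction_on generalizing u with
  | zero => rfl
  | succ k ih => rw [zpow_add_one, zpow_add_one, Equiv.Perm.mul_apply, ih,
      equiv_mul_apply]; rfl
  | pred k ih =>
    obtain ⟨w, rfl⟩ := A.phi.surjective u
    have e1 : (A.phi ^ (-(k:ℤ) - 1)) (A.phi w) = (A.phi ^ (-(k:ℤ))) w := by
      rw [← Equiv.Perm.mul_apply, ← zpow_add_one, sub_add_cancel]
    have e2 : (A.lin ^ (-(k:ℤ) - 1)) (A.lin (w : Cn n)) = (A.lin ^ (-(k:ℤ))) (w : Cn n) := by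
      rw [← equiv_mul_apply, ← zpow_add_one, sub_add_cancel]
    rw [e1, ih, ← e2]; rfl

lemma exists_zpow (γ : Subgroup.zpowers A.phi) :
    ∃ k : ℤ, A.phi ^ k = (γ : Equiv.Perm (PuncturedSpace n)) ∧ ∀ u : PuncturedSpace n, ((γ • u : PuncturedSpace n) : Cn n) = (A.lin ^ k) (u : Cn n) := by
  obtain ⟨_, k, rfl⟩ := γ
  exact ⟨k, rfl, fun u => A.phi_zpow_coe k u⟩

instance : ContinuousConstSMul (Subgroup.zpowers A.phi) (PuncturedSpace n) where
  continuous_const_smul γ := by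
    obtain ⟨k, -, hk⟩ := A.exists_zpow γ
    refine continuous_induced_rng.2 ?_
    have : (Subtype.val ∘ fun u : PuncturedSpace n => γ • u) = fun u : PuncturedSpace n => (A.lin ^ k) (u : Cn n) := funext hk
    rw [this]
    exact (A.lin ^ k).continuous.comp continuous_subtype_val

lemma puncturedSpace_norm_pos (u : PuncturedSpace n) : 0 < ‖(u : Cn n)‖ := norm_pos_iff.2 u.2

instance : IsCancelSMul (Subgroup.zpowers A.phi) (PuncturedSpace n) where
  right_cancel' γ γ' u h := by
    obtain ⟨k, hk, hk'⟩ := A.exists_zpow γ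
    obtain ⟨l, hl, hl'⟩ := A.exists_zpow γ'
    have e : A.ρ ^ k * ‖(u : Cn n)‖ = A.ρ ^ l * ‖(u : Cn n)‖ := by
      rw [← norm_lin_zpow, ← norm_lin_zpow, ← hk', ← hl', h]
    have e2 := mul_right_cancel₀ (puncturedSpace_norm_pos u).ne' e
    have : k = l := zpow_right_injective₀ A.pos A.lt1.ne e2
    subst this
    exact Subtype.ext (hk.symm.trans hl)

instance : ProperlyDiscontinuousSMul (Subgroup.zpowers A.phi) (PuncturedSpace n) where
  finite_disjoint_inter_image {K L} hK hL := by
    rcases K.eq_empty_or_nonempty with rfl | hKn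
    · simp
    rcases L.eq_empty_or_nonempty with rfl | hLn
    · simp
    have hc : Continuous fun u : PuncturedSpace n => ‖(u : Cn n)‖ := continuous_subtype_val.norm
    obtain ⟨u0, -, h0⟩ := hK.exists_isMinOn hKn hc.continuousOn
    obtain ⟨u1, -, h1⟩ := hK.exists_isMaxOn hKn hc.continuousOn
    obtain ⟨w0, -, g0⟩ := hL.exists_isMinOn hLn hc.continuousOn
    obtain ⟨w1, -, g1⟩ := hL.exists_isMaxOn hLn hc.continuousOn
    have p0 := puncturedSpace_norm_pos u0
    have p1 := puncturedSpace_norm_pos u1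
    have q0 := puncturedSpace_norm_pos w0
    have q1 := puncturedSpace_norm_pos w1
    obtain ⟨N, hN⟩ := exists_pow_lt_of_lt_one (div_pos q0 p1) A.lt1
    obtain ⟨N', hN'⟩ := exists_pow_lt_of_lt_one (div_pos p0 q1) A.lt1
    refine Set.Finite.subset (Set.Finite.image
      (fun k : ℤ => (⟨A.phi ^ k, k, rfl⟩ : Subgroup.zpowers A.phi)) (Set.finite_Icc (-(N' : ℤ)) N)) ?_
    rintro γ ⟨_, ⟨u, hu, rfl⟩, hw⟩
    obtain ⟨k, hk, hk'⟩ := A.exists_zpow γ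
    refine ⟨k, ⟨?_, ?_⟩, Subtype.ext hk⟩
    · by_contra! hlt
      have hn := A.norm_lin_zpow k u
      rw [← hk'] at hn
      have a1 : ‖((γ • u : PuncturedSpace n) : Cn n)‖ ≤ ‖(w1 : Cn n)‖ := g1 hw
      have a2 : ‖(u0 : Cn n)‖ ≤ ‖(u : Cn n)‖ := h0 hu
      have a3 : A.ρ ^ (-(N' : ℤ)) ≤ A.ρ ^ k :=
        zpow_le_zpow_right_of_le_one₀ A.pos A.lt1.le hlt.le
      rw [zpow_neg, zpow_natCast] at a3
      have a4 : ‖(w1 : Cn n)‖ / ‖(u0 : Cn n)‖ < (A.ρ ^ N')⁻¹ := by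
        rw [← inv_div]; exact inv_strictAnti₀ (pow_pos A.pos _) hN'
      have a5 : ‖(w1 : Cn n)‖ / ‖(u0 : Cn n)‖ < A.ρ ^ k := a4.trans_le a3
      rw [div_lt_iff₀ p0] at a5
      have := mul_le_mul_of_nonneg_left a2 (zpow_pos A.pos k).le
      linarith
    · by_contra! hlt
      have hn := A.norm_lin_zpow k u
      rw [← hk'] at hn
      have a1 : ‖(w0 : Cn n)‖ ≤ ‖((γ • u : PuncturedSpace n) : Cn n)‖ := g0 hw
      have a2 : ‖(u : Cn n)‖ ≤ ‖(u1 : Cn n)‖ := h1 hu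
      have a3 : A.ρ ^ k ≤ A.ρ ^ (N : ℤ) :=
        zpow_le_zpow_right_of_le_one₀ A.pos A.lt1.le hlt.le
      rw [zpow_natCast] at a3
      have a5 := a3.trans_lt hN
      rw [lt_div_iff₀ p1] at a5
      have := mul_le_mul_of_nonneg_left a2 (zpow_pos A.pos k).le
      linarith

/-- The quotient topology. -/
instance : TopologicalSpace A.HopfManifold :=
  inferInstanceAs (TopologicalSpace (MulAction.orbitRel.Quotient (Subgroup.zpowers A.phi) (PuncturedSpace n)))

instance : LocallyCompactSpace (PuncturedSpace n) := (PuncturedSpace n).isOpen.locallyCompactSpace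

/-- The charts are the local inverses of the projection `ℂⁿ ∖ {0} → (ℂⁿ ∖ {0}) / ⟨φ⟩`. -/
instance : ChartedSpace (Cn n) A.HopfManifold :=
  inferInstanceAs (ChartedSpace (Cn n)
    (MulAction.orbitRel.Quotient (Subgroup.zpowers A.phi) (PuncturedSpace n)))

/-- The projection `ℂⁿ ∖ {0} → (ℂⁿ ∖ {0}) / ⟨φ⟩`. -/
def proj : PuncturedSpace n → A.HopfManifold := Quotient.mk (MulAction.orbitRel (Subgroup.zpowers A.phi) (PuncturedSpace n))

lemma proj_smul (γ : Subgroup.zpowers A.phi) (u : PuncturedSpace n) : A.proj (γ • u) = A.proj u :=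
  Quotient.sound (MulAction.orbitRel_apply.2 ⟨γ, rfl⟩)

lemma proj_eq (u w : PuncturedSpace n) (h : A.proj u = A.proj w) : ∃ γ : Subgroup.zpowers A.phi, γ • u = w := by
  obtain ⟨γ, hγ⟩ := MulAction.orbitRel_apply.1 (Quotient.exact h.symm)
  exact ⟨γ, hγ⟩


lemma exists_section_aux (s : OpenPartialHomeomorph A.HopfManifold (PuncturedSpace n))
    (hs : (s.symm : PuncturedSpace n → A.HopfManifold) = A.proj) (x : PuncturedSpace n) :
    s.source = (s.trans (chartAt (Cn n) x)).source ∧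
      (s.symm : PuncturedSpace n → A.HopfManifold) = A.proj ∧ (∀ y, (s.trans (chartAt (Cn n) x)) y = (s y : Cn n)) ∧
      ∀ u ∈ s.target, (u : Cn n) ∈ (s.trans (chartAt (Cn n) x)).target ∧
        (s.trans (chartAt (Cn n) x)).symm u = A.proj u := by
  have h1 : s.source = (s.trans (chartAt (Cn n) x)).source := by
    ext y
    simp [TopologicalSpace.Opens.chartAt_eq, chartAt_self_eq]
  refine ⟨h1, hs, fun y => rfl, fun u hu => ?_⟩
  have h2 : s (A.proj u) = u := by rw [← hs]; exact s.right_inv hu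
  have h3 : A.proj u ∈ (s.trans (chartAt (Cn n) x)).source := by
    rw [← h1, ← hs]; exact s.map_target hu
  have h4 : (s.trans (chartAt (Cn n) x)) (A.proj u) = (u : Cn n) := by
    conv_rhs => rw [← h2]
    rfl
  rw [← h4]
  exact ⟨OpenPartialHomeomorph.map_source _ h3, OpenPartialHomeomorph.left_inv _ h3⟩

lemma exists_section {e : OpenPartialHomeomorph A.HopfManifold (Cn n)} (he : e ∈ atlas (Cn n) A.HopfManifold) :
    ∃ s : OpenPartialHomeomorph A.HopfManifold (PuncturedSpace n), s.source = e.source ∧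
      (s.symm : PuncturedSpace n → A.HopfManifold) = A.proj ∧ (∀ y, e y = (s y : Cn n)) ∧
      ∀ u ∈ s.target, (u : Cn n) ∈ e.target ∧ e.symm u = A.proj u := by
  obtain ⟨q, rfl⟩ := he
  exact ⟨_, A.exists_section_aux _ (IsLocalHomeomorph.localInverseAt_symm _ _) _⟩

lemma chart_eventually {e e' : OpenPartialHomeomorph A.HopfManifold (Cn n)}
    (he : e ∈ atlas (Cn n) A.HopfManifold) (he' : e' ∈ atlas (Cn n) A.HopfManifold) {y : A.HopfManifold}
    (hy : y ∈ e.source) (hy' : y ∈ e'.source) :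
    ∃ k : ℤ, ∀ᶠ x in nhds y, e' x = (A.lin ^ k) (e x) := by
  obtain ⟨s, hs, hsp, hse, -⟩ := A.exists_section he
  obtain ⟨s', hs', hsp', hse', -⟩ := A.exists_section he'
  have P : ∀ x ∈ e.source, A.proj (s x) = x := fun x hx => by
    rw [← hsp]; exact s.left_inv (hs ▸ hx)
  have P' : ∀ x ∈ e'.source, A.proj (s' x) = x := fun x hx => by
    rw [← hsp']; exact s'.left_inv (hs' ▸ hx)
  obtain ⟨γ, hγ⟩ := A.proj_eq (s y) (s' y) ((P y hy).trans (P' y hy').symm)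
  obtain ⟨k, -, hk⟩ := A.exists_zpow γ
  refine ⟨k, ?_⟩
  have c : ContinuousAt (fun x => γ • s x) y :=
    (continuous_const_smul γ).continuousAt.comp (s.continuousAt (hs ▸ hy))
  have m : ∀ᶠ x in nhds y, γ • s x ∈ s'.target := by
    refine c.eventually_mem (s'.open_target.mem_nhds ?_)
    rw [hγ]; exact s'.map_source (hs' ▸ hy')
  filter_upwards [m, e.open_source.mem_nhds hy] with x hx hxe
  rw [hse', hse, ← hk]
  congr 1
  have h1 := s'.right_inv hx
  rw [hsp', A.proj_smul, P x hxe] at h1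
  exact h1

lemma isManifold_aux (𝕜 : Type*) [NontriviallyNormedField 𝕜] [NormedSpace 𝕜 (Cn n)]
    (hlin : ∀ k : ℤ, ∀ m : ℕ∞ω, ContDiff 𝕜 m (fun z => (A.lin ^ k) z)) (m : ℕ∞ω) :
    IsManifold 𝓘(𝕜, Cn n) m A.HopfManifold := by
  refine isManifold_of_contDiffOn _ _ _ fun e e' he he' => ?_
  rintro z ⟨hz, -⟩
  have hz1 : z ∈ e.target := by
    have : z ∈ (e.symm.trans e').source := hz
    rw [OpenPartialHomeomorph.trans_source] at this
    exact this.1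
  have hz2 : e.symm z ∈ e'.source := by
    have : z ∈ (e.symm.trans e').source := hz
    rw [OpenPartialHomeomorph.trans_source] at this
    exact this.2
  obtain ⟨k, hk⟩ := A.chart_eventually he he' (e.map_target hz1) hz2
  refine ContDiffAt.contDiffWithinAt ?_
  refine (hlin k m).contDiffAt.congr_of_eventuallyEq ?_
  filter_upwards [(e.continuousAt_symm hz1).eventually hk, e.open_target.mem_nhds hz1] with w hw hw'
  change e' (e.symm w) = _
  rw [hw, e.right_inv hw']

/-- The Hopf manifold is a smooth (even analytic) real manifold. -/
instance (m : ℕ∞ω) : IsManifold 𝓘(ℝ, Cn n) m A.HopfManifold :=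
  A.isManifold_aux ℝ (fun k _ => ((A.lin ^ k).restrictScalars ℝ).contDiff) m

/-- The Hopf manifold is a complex manifold. -/
instance (m : ℕ∞ω) : IsManifold 𝓘(ℂ, Cn n) m A.HopfManifold :=
  A.isManifold_aux ℂ (fun k _ => (A.lin ^ k).contDiff) m

/-- The complex structure `J`: multiplication by `√-1` on the tangent spaces, read in the
(holomorphic) preferred chart; see `complexStructure_proj`. -/
def complexStructure (q : A.HopfManifold) : TangentSpace 𝓘(ℝ, Cn n) q →L[ℝ] TangentSpace 𝓘(ℝ, Cn n) q :=
  ((Complex.I • ContinuousLinearMap.id ℂ (Cn n)).restrictScalars ℝ : Cn n →L[ℝ] Cn n)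

lemma real_inner (v w : Cn n) : inner ℝ v w = (inner ℂ v w).re := by
  simp [PiLp.inner_apply]

lemma inner_lin (v w : Cn n) : inner ℝ (A.lin v) (A.lin w) = A.ρ ^ 2 * inner ℝ v w := by
  have h : ∀ i, ‖A.a i‖ ^ 2 = A.ρ ^ 2 := fun i => by rw [A.norm_eq]
  simp only [PiLp.inner_apply, Finset.mul_sum]
  refine Finset.sum_congr rfl fun i _ => ?_
  change inner ℝ (A.a i * v i) (A.a i * w i) = _
  rw [← h i, Complex.inner, Complex.inner, ← Complex.normSq_eq_norm_sq]
  simp [Complex.normSq_apply]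
  ring

lemma inner_lin_zpow (k : ℤ) (v w : Cn n) :
    inner ℝ ((A.lin ^ k) v) ((A.lin ^ k) w) = (A.ρ ^ k) ^ 2 * inner ℝ v w := by
  rw [real_inner_eq_norm_mul_self_add_norm_mul_self_sub_norm_sub_mul_self_div_two,
    real_inner_eq_norm_mul_self_add_norm_mul_self_sub_norm_sub_mul_self_div_two, ← map_sub]
  simp only [norm_lin_zpow]
  ring

lemma chart_ne_zero {e : OpenPartialHomeomorph A.HopfManifold (Cn n)} (he : e ∈ atlas (Cn n) A.HopfManifold)
    (y : A.HopfManifold) : e y ≠ 0 := by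
  obtain ⟨s, -, -, hse, -⟩ := A.exists_section he
  rw [hse]
  exact (s y).2

/-- The Euclidean inner product `Re ⟨v, w⟩` of `ℂⁿ`. -/
def reInner : Cn n →L[ℝ] Cn n →L[ℝ] ℝ := innerSL ℝ

lemma contDiffAt_coeff_smul {F : Type*} [NormedAddCommGroup F] [NormedSpace ℝ F] {z : Cn n}
    (hz : z ≠ 0) (c : F) : ContDiffAt ℝ ∞ (fun z : Cn n => (2 / ‖z‖ ^ 2) • c) z := by
  refine ContDiffAt.smul (contDiffAt_const.div (contDiff_norm_sq ℝ).contDiffAt ?_)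
    contDiffAt_const
  exact pow_ne_zero 2 (norm_ne_zero_iff.2 hz)

/-- The bilinear form `2 Re ⟨v, w⟩ / |z|²`, where `z` is the lift of `q` given by the preferred chart
at `q` (which is a local inverse of the projection). -/
def metricForm (q : A.HopfManifold) : Cn n →L[ℝ] Cn n →L[ℝ] ℝ :=
  (2 / ‖chartAt (Cn n) q q‖ ^ 2) • reInner

lemma metricForm_apply (q : A.HopfManifold) (v w : Cn n) :
    A.metricForm q v w = 2 / ‖chartAt (Cn n) q q‖ ^ 2 * inner ℝ v w := rfl

lemma metric_coeff_pos (q : A.HopfManifold) : 0 < 2 / ‖chartAt (Cn n) q q‖ ^ 2 := by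
  have := norm_pos_iff.2 (A.chart_ne_zero (chart_mem_atlas (Cn n) q) q)
  positivity

lemma coordChange (q₀ q : A.HopfManifold) (hq : q ∈ (chartAt (Cn n) q₀).source) :
    ∃ k : ℤ, chartAt (Cn n) q q = (A.lin ^ k) (chartAt (Cn n) q₀ q) ∧
      ∀ v : Cn n, (trivializationAt (Cn n) (TangentSpace 𝓘(ℝ, Cn n)) q₀).symmL ℝ q v
        = (A.lin ^ k) v := by
  obtain ⟨k, hk⟩ := A.chart_eventually (chart_mem_atlas (Cn n) q₀) (chart_mem_atlas (Cn n) q) hq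
    (mem_chart_source (Cn n) q)
  refine ⟨k, hk.self_of_nhds, fun v => ?_⟩
  have hz : chartAt (Cn n) q₀ q ∈ (chartAt (Cn n) q₀).target :=
    (chartAt (Cn n) q₀).map_source hq
  have hl := (chartAt (Cn n) q₀).left_inv hq
  have hk' : ∀ᶠ x in nhds ((chartAt (Cn n) q₀).symm (chartAt (Cn n) q₀ q)),
      chartAt (Cn n) q x = (A.lin ^ k) (chartAt (Cn n) q₀ x) := by rw [hl]; exact hk
  have hev : (fun z => chartAt (Cn n) q ((chartAt (Cn n) q₀).symm z)) =ᶠ[nhds (chartAt (Cn n) q₀ q)]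
      ((A.lin ^ k).restrictScalars ℝ : Cn n ≃L[ℝ] Cn n) := by
    filter_upwards [((chartAt (Cn n) q₀).continuousAt_symm hz).eventually hk',
      (chartAt (Cn n) q₀).open_target.mem_nhds hz] with w hw hw'
    rw [hw, (chartAt (Cn n) q₀).right_inv hw']; rfl
  rw [TangentBundle.symmL_trivializationAt_eq_core hq, tangentBundleCore_coordChange_achart]
  have hfd : HasFDerivAt (fun z => chartAt (Cn n) q ((chartAt (Cn n) q₀).symm z))
      (((A.lin ^ k).restrictScalars ℝ : Cn n ≃L[ℝ] Cn n) : Cn n →L[ℝ] Cn n)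
      (chartAt (Cn n) q₀ q) :=
    (ContinuousLinearEquiv.hasFDerivAt _).congr_of_eventuallyEq hev
  have := hfd.fderiv
  simp only [mfld_simps, fderivWithin_univ]
  change (fderiv ℝ (fun z => chartAt (Cn n) q ((chartAt (Cn n) q₀).symm z)) (chartAt (Cn n) q₀ q)) v = _
  rw [this]; rfl

/-- `metricForm` on the tangent space at `q`. -/
def metricInner (q : A.HopfManifold) :
    TangentSpace 𝓘(ℝ, Cn n) q →L[ℝ] TangentSpace 𝓘(ℝ, Cn n) q →L[ℝ] ℝ := A.metricForm q

lemma metricInner_apply (q : A.HopfManifold) (v w : TangentSpace 𝓘(ℝ, Cn n) q) :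
    A.metricInner q v w =
      2 / ‖chartAt (Cn n) q q‖ ^ 2 * @inner ℝ (Cn n) _ v w := rfl

/-- The Riemannian metric `g` with Kähler form `ω = √-1 ∂∂̄|z|² / |z|²`, i.e. the metric descending
from `2 Re ⟨v, w⟩ / |z|²` (so that `g(∂_k, ∂̄_l) = δ_{kl} / |z|²`); see `metric_proj`. -/
def metric : SmoothMetric 𝓘(ℝ, Cn n) A.HopfManifold where
  inner := A.metricInner
  symm q v w := by
    rw [metricInner_apply, metricInner_apply]
    exact congrArg _ (real_inner_comm (F := Cn n) w v)
  pos q v hv := by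
    rw [metricInner_apply]
    exact mul_pos (A.metric_coeff_pos q) (real_inner_self_pos (F := Cn n) |>.2 hv)
  isVonNBounded q := by
    change Bornology.IsVonNBounded ℝ {v : Cn n | A.metricForm q v v < 1}
    have hc := A.metric_coeff_pos q
    refine (NormedSpace.isVonNBounded_ball ℝ (Cn n) (Real.sqrt (2 / ‖chartAt (Cn n) q q‖ ^ 2)⁻¹)).subset ?_
    intro v hv
    have hv' : A.metricForm q v v < 1 := hv
    rw [metricForm_apply, real_inner_self_eq_norm_sq] at hv'
    rw [mem_ball_zero_iff]
    refine Real.lt_sqrt_of_sq_lt ?_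
    rw [← one_div, lt_div_iff₀ hc]
    linarith
  contMDiff := by
    intro q₀
    refine (contMDiffAt_section _).2 ?_
    have h0 : ContMDiffAt 𝓘(ℝ, Cn n) 𝓘(ℝ, Cn n →L[ℝ] Cn n →L[ℝ] ℝ) ∞
        (fun q : A.HopfManifold => (2 / ‖chartAt (Cn n) q₀ q‖ ^ 2) •
          (reInner : Cn n →L[ℝ] Cn n →L[ℝ] ℝ)) q₀ := by
      have h1 : ContDiffAt ℝ ∞ (fun z : Cn n => (2 / ‖z‖ ^ 2) •
          (reInner : Cn n →L[ℝ] Cn n →L[ℝ] ℝ)) (chartAt (Cn n) q₀ q₀) := by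
        have hne := A.chart_ne_zero (chart_mem_atlas (Cn n) q₀) q₀
        exact contDiffAt_coeff_smul hne _
      exact h1.contMDiffAt.comp q₀ (contMDiffAt_extChartAt (I := 𝓘(ℝ, Cn n)) (x := q₀))
    refine h0.congr_of_eventuallyEq ?_
    filter_upwards [(chartAt (Cn n) q₀).open_source.mem_nhds (mem_chart_source (Cn n) q₀)] with q hq
    obtain ⟨k, hk, hk'⟩ := A.coordChange q₀ q hq
    refine ContinuousLinearMap.ext fun v => ContinuousLinearMap.ext fun w => ?_
    have e2 : ∀ v, (trivializationAt (Cn n) (TangentSpace 𝓘(ℝ, Cn n)) q₀).symm q v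
        = (A.lin ^ k) v := fun v =>
      (Trivialization.symmL_apply (R := ℝ) _ hq _).symm.trans (hk' v)
    have e1 : ((trivializationAt (Cn n →L[ℝ] Cn n →L[ℝ] ℝ)
        (fun b : A.HopfManifold => TangentSpace 𝓘(ℝ, Cn n) b →L[ℝ] TangentSpace 𝓘(ℝ, Cn n) b →L[ℝ] ℝ) q₀)
        ⟨q, A.metricInner q⟩).2 v w = A.metricInner q
          ((trivializationAt (Cn n) (TangentSpace 𝓘(ℝ, Cn n)) q₀).symm q v)
          ((trivializationAt (Cn n) (TangentSpace 𝓘(ℝ, Cn n)) q₀).symm q w) := by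
      have hq' : q ∈ (trivializationAt (Cn n) (TangentSpace 𝓘(ℝ, Cn n) : A.HopfManifold → Type _) q₀).baseSet := hq
      refine (inCoordinates_apply_eq₂ (E₃ := fun _ : A.HopfManifold => ℝ) hq' hq' (Set.mem_univ _)).trans ?_
      simp
    refine e1.trans ?_
    rw [metricInner_apply, e2, e2, inner_lin_zpow, hk, norm_lin_zpow]
    have hp := zpow_pos A.pos k
    change _ = 2 / ‖chartAt (Cn n) q₀ q‖ ^ 2 * inner ℝ v w
    have := norm_pos_iff.2 (A.chart_ne_zero (chart_mem_atlas (Cn n) q₀) q)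
    field_simp


lemma continuous_proj : Continuous A.proj := continuous_quot_mk

lemma chart_proj_eventually (u : PuncturedSpace n) :
    ∃ k : ℤ, ∀ᶠ w in nhds u, chartAt (Cn n) (A.proj u) (A.proj w) = (A.lin ^ k) (w : Cn n) := by
  obtain ⟨s, hs, hsp, hse, -⟩ := A.exists_section (chart_mem_atlas (Cn n) (A.proj u))
  have hy : A.proj u ∈ s.source := hs ▸ mem_chart_source (Cn n) (A.proj u)
  have P : A.proj (s (A.proj u)) = A.proj u := by
    rw [← hsp]; exact s.left_inv (by rwa [hsp])
  obtain ⟨γ, hγ⟩ := A.proj_eq u (s (A.proj u)) P.symm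
  obtain ⟨k, -, hk⟩ := A.exists_zpow γ
  refine ⟨k, ?_⟩
  have m : ∀ᶠ w in nhds u, γ • w ∈ s.target := by
    refine (continuous_const_smul γ).continuousAt.eventually_mem (s.open_target.mem_nhds ?_)
    rw [hγ]; exact s.map_source hy
  filter_upwards [m] with w hw
  rw [hse, ← hk]
  congr 1
  have h1 := s.right_inv hw
  rw [hsp, A.proj_smul] at h1
  exact h1

lemma hasMFDerivAt_proj (u : PuncturedSpace n) :
    ∃ k : ℤ, chartAt (Cn n) (A.proj u) (A.proj u) = (A.lin ^ k) (u : Cn n) ∧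
      HasMFDerivAt 𝓘(ℝ, Cn n) 𝓘(ℝ, Cn n) A.proj u
        (((A.lin ^ k).restrictScalars ℝ : Cn n ≃L[ℝ] Cn n) : Cn n →L[ℝ] Cn n) := by
  obtain ⟨k, hk⟩ := A.chart_proj_eventually u
  refine ⟨k, hk.self_of_nhds, A.continuous_proj.continuousAt, ?_⟩
  have hu : (chartAt (Cn n) u : PuncturedSpace n → Cn n) = Subtype.val := by
    simp [TopologicalSpace.Opens.chartAt_eq, chartAt_self_eq]
    rfl
  have ht := mem_chart_target (Cn n) u
  have hk' : ∀ᶠ w in nhds ((chartAt (Cn n) u).symm (chartAt (Cn n) u u)),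
      chartAt (Cn n) (A.proj u) (A.proj w) = (A.lin ^ k) (w : Cn n) := by
    rwa [(chartAt (Cn n) u).left_inv (mem_chart_source (Cn n) u)]
  have hfd : HasFDerivAt (fun z => chartAt (Cn n) (A.proj u) (A.proj ((chartAt (Cn n) u).symm z)))
      (((A.lin ^ k).restrictScalars ℝ : Cn n ≃L[ℝ] Cn n) : Cn n →L[ℝ] Cn n)
      (chartAt (Cn n) u u) := by
    refine (ContinuousLinearEquiv.hasFDerivAt _).congr_of_eventuallyEq ?_
    filter_upwards [((chartAt (Cn n) u).continuousAt_symm ht).eventually hk',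
      (chartAt (Cn n) u).open_target.mem_nhds ht] with z hz hz'
    have h1 := (chartAt (Cn n) u).right_inv hz'
    rw [hu] at h1
    rw [hz, h1]
    rfl
  simp only [mfld_simps]
  exact hfd.hasFDerivWithinAt

/-- The projection is holomorphic. -/
theorem contMDiff_proj : ContMDiff 𝓘(ℂ, Cn n) 𝓘(ℂ, Cn n) ω A.proj := by
  intro u
  obtain ⟨k, hk⟩ := A.chart_proj_eventually u
  rw [contMDiffAt_iff_target]
  refine ⟨A.continuous_proj.continuousAt, ?_⟩
  have h : ContMDiffAt 𝓘(ℂ, Cn n) 𝓘(ℂ, Cn n) ω (fun w : PuncturedSpace n => (A.lin ^ k) (w : Cn n)) u :=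
    (A.lin ^ k).contDiff.contMDiff.contMDiffAt.comp u contMDiff_subtype_val.contMDiffAt
  exact h.congr_of_eventuallyEq (by filter_upwards [hk] with w hw; simpa using hw)

/-- The metric pulls back under the projection to `2 Re ⟨v, w⟩ / |z|²`. -/
theorem metric_proj (u : PuncturedSpace n) (v w : TangentSpace 𝓘(ℝ, Cn n) u) :
    A.metric.inner (A.proj u) (mfderiv 𝓘(ℝ, Cn n) 𝓘(ℝ, Cn n) A.proj u v)
        (mfderiv 𝓘(ℝ, Cn n) 𝓘(ℝ, Cn n) A.proj u w)
      = 2 * (@inner ℂ (Cn n) _ v w).re / ‖(u : Cn n)‖ ^ 2 := by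
  obtain ⟨k, hk, hd⟩ := A.hasMFDerivAt_proj u
  rw [hd.mfderiv]
  refine (A.metricInner_apply _ _ _).trans ?_
  have h1 : @inner ℝ (Cn n) _ ((A.lin ^ k) v) ((A.lin ^ k) w)
      = (A.ρ ^ k) ^ 2 * (@inner ℂ (Cn n) _ v w).re :=
    (A.inner_lin_zpow k v w).trans (congrArg _ (real_inner (n := n) v w))
  refine (congrArg _ h1).trans ?_
  rw [hk, norm_lin_zpow]
  have hp := zpow_pos A.pos k
  have := puncturedSpace_norm_pos u
  field_simp

/-- The differential of the projection intertwines multiplication by `√-1` with `J`. -/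
theorem complexStructure_proj (u : PuncturedSpace n) (v : Cn n) :
    A.complexStructure (A.proj u) (mfderiv 𝓘(ℝ, Cn n) 𝓘(ℝ, Cn n) A.proj u v)
      = mfderiv 𝓘(ℝ, Cn n) 𝓘(ℝ, Cn n) A.proj u (Complex.I • v : Cn n) := by
  obtain ⟨k, hk, hd⟩ := A.hasMFDerivAt_proj u
  rw [hd.mfderiv]
  exact ((A.lin ^ k).map_smul Complex.I v).symm

end HopfMultiplier

end HopfManifold

end HopfDefinitions

/-!
The Hopf manifold inherits from `ℂⁿ ∖ {0}` an affine structure whose transition maps are powers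
of `A.lin`, a multiple of a unitary map. Hence every `A.lin`-invariant tensor of Christoffel symbols
on `ℂⁿ ∖ {0}` gives a connection `flatConnection + Γ`. Consider the three-parameter family
`hopfConnection t m b` with

`|z|² Γ_X Y = (-Re ⟨z, X⟩ + i t Im ⟨z, X⟩) Y - (m Re ⟨z, Y⟩ + i b Im ⟨z, Y⟩) X`
`  + (m Re ⟨X, Y⟩ + i b Im ⟨X, Y⟩) z`.

All its members preserve the metric `2 Re ⟨·, ·⟩ / |z|²`, those with `m = b` preserve `J`, and their
torsion is the skew part of `Γ`. So the Levi-Civita, Chern and Bismut connections are the members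
`(0, 1, 0)`, `(-1, 0, 0)` and `(1, 1, 1)`; that there are no others follows by looking at the
difference tensor of two such connections (`leviCivita_unique`, `chern_unique`, `bismut_unique`).
Since `Γ` is affine in the parameters, `D^r_s` is the member with `t = m + b - 1`,
`m = (1 - r + rs + s) / 2`, `b = (1 - r + rs - s) / 2` (`canonical_eq`).

The curvature is the same algebraic expression at every point (`curv`, `curvature_hopfConnection`),
and only involves the components of the vectors along `z` and their mutual inner products. A vector
`u` lies in the complex plane spanned by `z` and an orthogonal vector `e` of the same length, where
the curvature becomes a polynomial in the coordinates (`IsFrame.curv_eq`). For `u = c₁ z + c₂ e` the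
holomorphic sectional curvature is

`(2 - m² - b²) / 2 · |c₂|² / (|c₁|² + |c₂|²)`, with `2 - m² - b² = (4 - (1 - r + rs)² - s²) / 2`

(`sectionalCurvature_eq`). It is nonconstant off `chenNieCurve`, and zero on it. A flat connection
therefore has its parameters on this curve; two more components of the curvature in the frame are
`i (m + b) (1 - b)` and `(m + b) (m - 1)`, and together with `m² + b² = 2` their vanishing leaves
`(m, b) = (1, 1)`, `(1, -1)`, `(-1, 1)`. In these three cases the curvature vanishes on the plane of
the frame, hence everywhere if `n = 2`; if `n ≥ 3` and `f` is orthogonal to `z` and `e`, then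
`R(e, ie) f = 2 i t f` with `t = ±1` (`flat_parameters`).
-/

noncomputable section

/-! ### Tangent vectors and vector fields in the charts of the Hopf manifold -/

namespace HopfMultiplier

variable {n : ℕ} (A : HopfMultiplier n)

/-- The coordinates of tangent vectors at `y` in the preferred chart at `x` (zero when `y` is
outside the domain of this chart). -/
def coord (x y : A.HopfManifold) : TangentSpace 𝓘(ℝ, Cn n) y →L[ℝ] Cn n :=
  (trivializationAt (Cn n) (TangentSpace 𝓘(ℝ, Cn n)) x).continuousLinearMapAt ℝ y

variable {A}

/-- At its own base point the preferred chart reads a tangent vector as itself. -/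
lemma coord_self (x : A.HopfManifold) (v : TangentSpace 𝓘(ℝ, Cn n) x) :
    A.coord x x v = v := by
  have hx : x ∈ (chartAt (Cn n) x).source := mem_chart_source _ x
  unfold coord
  rw [TangentBundle.continuousLinearMapAt_trivializationAt_eq_core hx]
  exact (tangentBundleCore 𝓘(ℝ, Cn n) A.HopfManifold).coordChange_self (achart (Cn n) x) x hx v

lemma coord_eq {x y : A.HopfManifold} (hy : y ∈ (chartAt (Cn n) x).source)
    (v : TangentSpace 𝓘(ℝ, Cn n) y) :
    A.coord x y v = (trivializationAt (Cn n) (TangentSpace 𝓘(ℝ, Cn n)) x ⟨y, v⟩).2 :=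
  congrFun (Trivialization.coe_continuousLinearEquivAt_eq (R := ℝ)
    (trivializationAt (Cn n) (TangentSpace 𝓘(ℝ, Cn n)) x) (b := y) hy).symm v

/-- The tangent space at `y` is read in the preferred chart at `y`; it is compared with the chart at
`x` through one power of `A.lin`, the same for the points and for the tangent vectors. -/
lemma exists_coord {x y : A.HopfManifold} (hy : y ∈ (chartAt (Cn n) x).source) :
    ∃ k : ℤ, chartAt (Cn n) y y = (A.lin ^ k) (chartAt (Cn n) x y) ∧
      ∀ v : TangentSpace 𝓘(ℝ, Cn n) y, v = (A.lin ^ k) (A.coord x y v) := by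
  obtain ⟨k, hk, hk'⟩ := A.coordChange x y hy
  refine ⟨k, hk, fun v => ?_⟩
  have := hk' (A.coord x y v)
  rw [← this]
  exact (Trivialization.symmL_continuousLinearMapAt (R := ℝ)
    (trivializationAt (Cn n) (TangentSpace 𝓘(ℝ, Cn n)) x) (b := y) hy v).symm

lemma chart_ne {x y : A.HopfManifold} : chartAt (Cn n) x y ≠ 0 :=
  A.chart_ne_zero (chart_mem_atlas _ _) _

lemma lin_zpow_add (k l : ℤ) (v : Cn n) : (A.lin ^ (k + l)) v = (A.lin ^ k) ((A.lin ^ l) v) := by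
  rw [zpow_add, equiv_mul_apply]

/-- The exponent `k` can be read off from norms, since `A.lin` scales them by `ρ < 1`. -/
lemma zpow_exponent_unique {k l : ℤ} {v : Cn n} (hv : v ≠ 0)
    (h : (A.lin ^ k) v = (A.lin ^ l) v) : k = l := by
  have h2 := congrArg norm h
  rw [norm_lin_zpow, norm_lin_zpow] at h2
  exact zpow_right_injective₀ A.pos A.lt1.ne (mul_right_cancel₀ (norm_ne_zero_iff.2 hv) h2)

/-- The transition between the preferred charts is locally one fixed power of the linear map
`A.lin`, both on points and on tangent vectors. -/
lemma transition {x y₀ : A.HopfManifold} (h : y₀ ∈ (chartAt (Cn n) x).source) :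
    ∃ k : ℤ, ∀ᶠ y in nhds y₀, chartAt (Cn n) y₀ y = (A.lin ^ k) (chartAt (Cn n) x y) ∧
      ∀ v : TangentSpace 𝓘(ℝ, Cn n) y, A.coord y₀ y v = (A.lin ^ k) (A.coord x y v) := by
  obtain ⟨k, hk⟩ := A.chart_eventually (chart_mem_atlas (Cn n) x) (chart_mem_atlas (Cn n) y₀) h
    (mem_chart_source (Cn n) y₀)
  refine ⟨k, ?_⟩
  filter_upwards [hk, (chartAt (Cn n) x).open_source.mem_nhds h,
    (chartAt (Cn n) y₀).open_source.mem_nhds (mem_chart_source (Cn n) y₀)] with y hy hyx hy0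
  refine ⟨hy, fun v => ?_⟩
  obtain ⟨k1, h1, h1'⟩ := exists_coord hyx
  obtain ⟨k2, h2, h2'⟩ := exists_coord hy0
  have e : k1 = k2 + k := by
    refine zpow_exponent_unique (A := A) (v := chartAt (Cn n) x y) chart_ne ?_
    rw [← h1, h2, hy, lin_zpow_add]
  have h3 : (A.lin ^ k2) (A.coord y₀ y v) = (A.lin ^ k1) (A.coord x y v) :=
    (h2' v).symm.trans (h1' v)
  rw [e, lin_zpow_add] at h3
  exact (A.lin ^ k2).injective h3

/-- A vector field is differentiable exactly when its coordinates are. -/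
lemma diffFieldAt_iff {x y : A.HopfManifold} (hy : y ∈ (chartAt (Cn n) x).source)
    {X : Π y : A.HopfManifold, TangentSpace 𝓘(ℝ, Cn n) y} :
    AffineConnection.DiffFieldAt X y ↔
      MDifferentiableAt 𝓘(ℝ, Cn n) 𝓘(ℝ, Cn n) (fun y => A.coord x y (X y)) y := by
  unfold AffineConnection.DiffFieldAt
  refine (Trivialization.mdifferentiableAt_section_iff 𝓘(ℝ, Cn n)
    (trivializationAt (Cn n) (TangentSpace 𝓘(ℝ, Cn n)) x) X (b₀ := y) hy).trans ?_
  refine Filter.EventuallyEq.mdifferentiableAt_iff ?_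
  filter_upwards [(chartAt (Cn n) x).open_source.mem_nhds hy] with z hz
  exact (coord_eq hz _).symm

lemma diffFieldAt_iff_self {x : A.HopfManifold}
    {X : Π y : A.HopfManifold, TangentSpace 𝓘(ℝ, Cn n) y} :
    AffineConnection.DiffFieldAt X x ↔
      MDifferentiableAt 𝓘(ℝ, Cn n) 𝓘(ℝ, Cn n) (fun y => A.coord x y (X y)) x :=
  diffFieldAt_iff (mem_chart_source _ x)

/-- The field extending `v` has constant coordinates in the chart at `x`. -/
lemma coord_extend {x y : A.HopfManifold} (hy : y ∈ (chartAt (Cn n) x).source)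
    (v : TangentSpace 𝓘(ℝ, Cn n) x) :
    A.coord x y (FiberBundle.extend (Cn n) v y) = v := by
  have h1 : FiberBundle.extend (Cn n) v y =
      (trivializationAt (Cn n) (TangentSpace 𝓘(ℝ, Cn n)) x).symmL ℝ y (A.coord x x v) := by
    rw [coord_eq (mem_chart_source _ x)]
    exact (Trivialization.symmL_apply (R := ℝ)
      (trivializationAt (Cn n) (TangentSpace 𝓘(ℝ, Cn n)) x) (b := y) hy _).symm
  rw [h1, coord_self]
  exact Trivialization.continuousLinearMapAt_symmL (R := ℝ)
    (trivializationAt (Cn n) (TangentSpace 𝓘(ℝ, Cn n)) x) (b := y) hy v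

/-- The tangent space at `x` being read in the chart at `x`, the derivative of this chart is the
identity. -/
lemma mfderiv_chart (x : A.HopfManifold) :
    HasMFDerivAt 𝓘(ℝ, Cn n) 𝓘(ℝ, Cn n) (chartAt (Cn n) x) x
      (ContinuousLinearMap.id ℝ (Cn n)) := by
  have h1 : MDifferentiableAt 𝓘(ℝ, Cn n) 𝓘(ℝ, Cn n) (chartAt (Cn n) x) x :=
    mdifferentiableAt_extChartAt (I := 𝓘(ℝ, Cn n)) (mem_chart_source (Cn n) x)
  have h2 := h1.hasMFDerivAt
  have h3 := TangentBundle.continuousLinearMapAt_trivializationAt (I := 𝓘(ℝ, Cn n))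
    (mem_chart_source (Cn n) x)
  have h4 : mfderiv 𝓘(ℝ, Cn n) 𝓘(ℝ, Cn n) (chartAt (Cn n) x) x =
      ContinuousLinearMap.id ℝ (Cn n) := by
    refine Eq.trans ?_ (h3.symm.trans (ContinuousLinearMap.ext fun v => coord_self x v))
    simp only [mfld_simps]
  rwa [h4] at h2

lemma inverse_apply_of_eq_symm {F G : Type*} [NormedAddCommGroup F] [NormedSpace ℝ F]
    [AddCommGroup G] [Module ℝ G] [TopologicalSpace G] (e : G ≃L[ℝ] F) (f : F →L[ℝ] G)
    (h : f = e.symm) (v : G) : f.inverse v = e v := by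
  subst h
  rw [ContinuousLinearMap.inverse_equiv]
  rfl

/-- The bracket of two fields with constant coordinates in the preferred chart vanishes. -/
lemma mlieBracket_extend (x : A.HopfManifold) (u v : TangentSpace 𝓘(ℝ, Cn n) x) :
    VectorField.mlieBracket 𝓘(ℝ, Cn n) (FiberBundle.extend (Cn n) u)
      (FiberBundle.extend (Cn n) v) x = 0 := by
  -- the pulled back fields, whose Lie bracket defines the bracket on the manifold, are constant
  have key : ∀ w : TangentSpace 𝓘(ℝ, Cn n) x,
      VectorField.mpullbackWithin 𝓘(ℝ, Cn n) 𝓘(ℝ, Cn n) (extChartAt 𝓘(ℝ, Cn n) x).symm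
        (FiberBundle.extend (Cn n) w) (Set.range 𝓘(ℝ, Cn n))
        =ᶠ[nhds (extChartAt 𝓘(ℝ, Cn n) x x)] fun _ => (w : Cn n) := by
    intro w
    filter_upwards [(isOpen_extChartAt_target x).mem_nhds (mem_extChartAt_target x)] with z hz
    set y := (extChartAt 𝓘(ℝ, Cn n) x).symm z with hy
    have hys : y ∈ (chartAt (Cn n) x).source := by
      have := (extChartAt 𝓘(ℝ, Cn n) x).map_target hz
      rwa [extChartAt_source] at this
    have hz' : extChartAt 𝓘(ℝ, Cn n) x y = z := (extChartAt 𝓘(ℝ, Cn n) x).right_inv hz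
    have e := TangentBundle.symmL_trivializationAt (I := 𝓘(ℝ, Cn n)) hys
    rw [hz'] at e
    have e2 := Trivialization.symm_continuousLinearEquivAt_eq' (R := ℝ)
      (trivializationAt (Cn n) (TangentSpace 𝓘(ℝ, Cn n)) x) (b := y) hys
    refine (inverse_apply_of_eq_symm _ _ (e.symm.trans e2.symm) _).trans ?_
    exact (congrFun (Trivialization.coe_continuousLinearEquivAt_eq (R := ℝ)
      (trivializationAt (Cn n) (TangentSpace 𝓘(ℝ, Cn n)) x) (b := y) hys) _).trans
      (coord_extend hys w)
  have h0 : VectorField.lieBracketWithin ℝ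
      (VectorField.mpullbackWithin 𝓘(ℝ, Cn n) 𝓘(ℝ, Cn n) (extChartAt 𝓘(ℝ, Cn n) x).symm
        (FiberBundle.extend (Cn n) u) (Set.range 𝓘(ℝ, Cn n)))
      (VectorField.mpullbackWithin 𝓘(ℝ, Cn n) 𝓘(ℝ, Cn n) (extChartAt 𝓘(ℝ, Cn n) x).symm
        (FiberBundle.extend (Cn n) v) (Set.range 𝓘(ℝ, Cn n)))
      ((extChartAt 𝓘(ℝ, Cn n) x).symm ⁻¹' Set.univ ∩ Set.range 𝓘(ℝ, Cn n))
      (extChartAt 𝓘(ℝ, Cn n) x x) = 0 := by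
    refine (Filter.EventuallyEq.lieBracketWithin_vectorField_eq
      ((key u).filter_mono nhdsWithin_le_nhds) (key u).self_of_nhds
      ((key v).filter_mono nhdsWithin_le_nhds) (key v).self_of_nhds).trans ?_
    have hconst : ∀ (a b z : Cn n) (s : Set (Cn n)),
        VectorField.lieBracketWithin ℝ (fun _ : Cn n => a) (fun _ => b) s z = 0 := by
      intro a b z s
      simp [VectorField.lieBracketWithin]
    exact hconst _ _ _ _
  exact (congrArg _ h0).trans (map_zero _)

end HopfMultiplier

/-! ### The Christoffel symbols of the family and the resulting curvature tensor -/

namespace HopfAlgebra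

variable {n : ℕ} (t m b : ℝ)

open ComplexConjugate

/-- The real-linear map of `ℂ` that scales the real part by `k` and the imaginary part by `l`. -/
def twist (k l : ℝ) (c : ℂ) : ℂ := ⟨k * c.re, l * c.im⟩

/-- The numerator of the Christoffel symbols at `z`, where `X` is the direction of differentiation.
The first coefficient has real part `-Re ⟨z, X⟩`, which is what compatibility with the conformally
flat metric requires; the other parts are free, and the pair of terms with the coefficients `m`, `b`
is skew-adjoint in `Y` for the real inner product. -/
def christoffelNum (z X Y : Cn n) : Cn n :=
  twist (-1) t (inner ℂ z X) • Y - twist m b (inner ℂ z Y) • X + twist m b (inner ℂ X Y) • z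

lemma twist_add (k l : ℝ) (c d : ℂ) : twist k l (c + d) = twist k l c + twist k l d := by
  apply Complex.ext <;> simp [twist] <;> ring

lemma twist_real_mul (k l r : ℝ) (c : ℂ) : twist k l (r * c) = r * twist k l c := by
  apply Complex.ext <;> simp [twist] <;> ring

lemma real_smul_eq (r : ℝ) (v : Cn n) : r • v = (r : ℂ) • v := by
  ext i; simp

lemma christoffelNum_add₁ (z z' X Y : Cn n) :
    christoffelNum t m b (z + z') X Y =
      christoffelNum t m b z X Y + christoffelNum t m b z' X Y := by
  simp only [christoffelNum, inner_add_left, twist_add]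
  module

lemma christoffelNum_add₂ (z X X' Y : Cn n) :
    christoffelNum t m b z (X + X') Y =
      christoffelNum t m b z X Y + christoffelNum t m b z X' Y := by
  simp only [christoffelNum, inner_add_left, inner_add_right, twist_add]
  module

lemma christoffelNum_add₃ (z X Y Y' : Cn n) :
    christoffelNum t m b z X (Y + Y') =
      christoffelNum t m b z X Y + christoffelNum t m b z X Y' := by
  simp only [christoffelNum, inner_add_right, twist_add]
  module

lemma christoffelNum_smul₁ (r : ℝ) (z X Y : Cn n) :
    christoffelNum t m b (r • z) X Y =
      r • christoffelNum t m b z X Y := by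
  simp only [christoffelNum, real_smul_eq, inner_smul_left, Complex.conj_ofReal, twist_real_mul]
  module

lemma christoffelNum_smul₂ (r : ℝ) (z X Y : Cn n) :
    christoffelNum t m b z (r • X) Y =
      r • christoffelNum t m b z X Y := by
  simp only [christoffelNum, real_smul_eq, inner_smul_left, inner_smul_right, Complex.conj_ofReal,
    twist_real_mul]
  module

lemma christoffelNum_smul₃ (r : ℝ) (z X Y : Cn n) :
    christoffelNum t m b z X (r • Y) =
      r • christoffelNum t m b z X Y := by
  simp only [christoffelNum, real_smul_eq, inner_smul_right, twist_real_mul]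
  module

/-- `christoffelNum` as a real-linear function of the base point. -/
def christoffelNumBase (X Y : Cn n) : Cn n →L[ℝ] Cn n :=
  LinearMap.toContinuousLinearMap
    { toFun := fun z => christoffelNum t m b z X Y
      map_add' := fun z z' => christoffelNum_add₁ t m b z z' X Y
      map_smul' := fun r z => christoffelNum_smul₁ t m b r z X Y }

lemma christoffelNumBase_apply (z X Y : Cn n) :
    christoffelNumBase t m b X Y z = christoffelNum t m b z X Y := rfl

/-- The Christoffel symbols `Γ_X Y` at `z` of the member `(t, m, b)` of the family. -/
def christoffel (z X Y : Cn n) : Cn n := (‖z‖ ^ 2)⁻¹ • christoffelNum t m b z X Y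

/-- The Christoffel symbols at `z` as a bilinear map; the differentiated field `Y` is the first
argument, as in `CovariantDerivative`. -/
def christoffelL (z : Cn n) : Cn n →L[ℝ] Cn n →L[ℝ] Cn n :=
  LinearMap.toContinuousBilinearMap <| LinearMap.mk₂ ℝ (fun Y X => christoffel t m b z X Y)
    (fun Y Y' X => by simp only [christoffel, christoffelNum_add₃, smul_add])
    (fun r Y X => by simp only [christoffel, christoffelNum_smul₃, smul_comm r])
    (fun Y X X' => by simp only [christoffel, christoffelNum_add₂, smul_add])
    (fun r Y X => by simp only [christoffel, christoffelNum_smul₂, smul_comm r])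

/-- The curvature `R_{uv} w = ∂_u Γ_v w - ∂_v Γ_u w + Γ_u Γ_v w - Γ_v Γ_u w` at `z` of the member
`(t, m, b)` of the family, with the derivatives written out. -/
def curv (z u v w : Cn n) : Cn n :=
  (‖z‖ ^ 2)⁻¹ • (christoffelNum t m b u v w - christoffelNum t m b v u w)
  - (2 * ((‖z‖ ^ 2)⁻¹) ^ 2) • ((inner ℂ z u : ℂ).re • christoffelNum t m b z v w
      - (inner ℂ z v : ℂ).re • christoffelNum t m b z u w)
  + (((‖z‖ ^ 2)⁻¹) ^ 2) •
      (christoffelNum t m b z u (christoffelNum t m b z v w) -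
        christoffelNum t m b z v (christoffelNum t m b z u w))

lemma hasFDerivAt_christoffel {z : Cn n} (hz : z ≠ 0) (X Y : Cn n) :
    ∃ T : Cn n →L[ℝ] Cn n, HasFDerivAt (fun z => christoffel t m b z X Y) T z ∧
      ∀ u, T u = (‖z‖ ^ 2)⁻¹ • christoffelNum t m b u X Y
        - (2 * ((‖z‖ ^ 2)⁻¹) ^ 2 * (inner ℂ z u : ℂ).re) • christoffelNum t m b z X Y := by
  have h0 : ‖z‖ ^ 2 ≠ 0 := pow_ne_zero 2 (norm_ne_zero_iff.2 hz)
  have h1 : HasFDerivAt (fun z : Cn n => ‖z‖ ^ 2) (2 • innerSL ℝ z) z :=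
    (hasStrictFDerivAt_norm_sq z).hasFDerivAt
  have h2 := ((hasDerivAt_inv h0).comp_hasFDerivAt z h1).fun_smul
    (christoffelNumBase t m b X Y).hasFDerivAt
  refine ⟨_, h2, fun u => ?_⟩
  have h3 : inner ℝ z u = (inner ℂ z u : ℂ).re := HopfMultiplier.real_inner z u
  simp [christoffelNumBase_apply, h3]
  module

lemma curv_eq_of_deriv {z u v w : Cn n} {Tv Tu : Cn n →L[ℝ] Cn n}
    (hv : Tv u = (‖z‖ ^ 2)⁻¹ • christoffelNum t m b u v w
        - (2 * ((‖z‖ ^ 2)⁻¹) ^ 2 * (inner ℂ z u : ℂ).re) • christoffelNum t m b z v w)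
    (hu : Tu v = (‖z‖ ^ 2)⁻¹ • christoffelNum t m b v u w
        - (2 * ((‖z‖ ^ 2)⁻¹) ^ 2 * (inner ℂ z v : ℂ).re) • christoffelNum t m b z u w) :
    Tv u - Tu v + (christoffel t m b z u (christoffel t m b z v w)
      - christoffel t m b z v (christoffel t m b z u w)) = curv t m b z u v w := by
  rw [hv, hu]
  simp only [christoffel, curv, christoffelNum_smul₃]
  module

/-! ### The curvature in a frame adapted to the position vector -/

/-- `e` completes the position vector `z` to an orthogonal frame of a complex plane, in which both
vectors have the same length (so that they are orthonormal, up to a constant, for the metric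
at `z`). -/
structure IsFrame (z e : Cn n) : Prop where
  pos : 0 < ‖z‖
  orth : inner ℂ z e = (0 : ℂ)
  norm_eq : ‖e‖ = ‖z‖

/-- The standard Hermitian form of `ℂ²`, conjugate-linear in the first argument. -/
def herm (x y : ℂ × ℂ) : ℂ := conj x.1 * y.1 + conj x.2 * y.2

/-- `christoffelNum` in the coordinates of a frame, up to the factor `|z|²`. -/
def frameNum (a x y : ℂ × ℂ) : ℂ × ℂ :=
  twist (-1) t (herm a x) • y - twist m b (herm a y) • x + twist m b (herm x y) • a

/-- The curvature tensor `curv` in the coordinates of a frame, in which `z` is `(1, 0)`. The factors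
`|z|²` cancel. -/
def frameCurv (u v w : ℂ × ℂ) : ℂ × ℂ :=
  (frameNum t m b u v w - frameNum t m b v u w)
  - (2 : ℝ) • (u.1.re • frameNum t m b (1, 0) v w - v.1.re • frameNum t m b (1, 0) u w)
  + (frameNum t m b (1, 0) u (frameNum t m b (1, 0) v w) -
      frameNum t m b (1, 0) v (frameNum t m b (1, 0) u w))

/-- The vector with the coordinates `x` in the frame `z`, `e`. -/
def comb (z e : Cn n) (x : ℂ × ℂ) : Cn n := x.1 • z + x.2 • e

variable {z e : Cn n}

lemma comb_add (x y : ℂ × ℂ) : comb z e (x + y) = comb z e x + comb z e y := by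
  simp only [comb, Prod.fst_add, Prod.snd_add]; module

lemma comb_sub (x y : ℂ × ℂ) : comb z e (x - y) = comb z e x - comb z e y := by
  simp only [comb, Prod.fst_sub, Prod.snd_sub]; module

lemma comb_smul (c : ℂ) (x : ℂ × ℂ) : comb z e (c • x) = c • comb z e x := by
  simp only [comb, Prod.smul_fst, Prod.smul_snd, smul_eq_mul]; module

lemma comb_real_smul (r : ℝ) (x : ℂ × ℂ) : comb z e (r • x) = r • comb z e x := by
  rw [real_smul_eq, ← comb_smul]
  rfl

lemma comb_one_zero : comb z e (1, 0) = z := by simp [comb]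

lemma comb_zero_one : comb z e (0, 1) = e := by simp [comb]

lemma IsFrame.inner_eq (hf : IsFrame z e) (x y : ℂ × ℂ) :
    inner ℂ (comb z e x) (comb z e y) = ((‖z‖ ^ 2 : ℝ) : ℂ) * herm x y := by
  have h1 : inner ℂ e z = (0 : ℂ) := inner_eq_zero_symm.1 hf.orth
  simp only [comb, inner_add_left, inner_add_right, inner_smul_left, inner_smul_right, hf.orth, h1,
    inner_self_eq_norm_sq_to_K, hf.norm_eq, herm, Complex.coe_algebraMap]
  push_cast
  ring

lemma IsFrame.christoffelNum_eq (hf : IsFrame z e) (a x y : ℂ × ℂ) :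
    christoffelNum t m b (comb z e a) (comb z e x) (comb z e y) =
      ‖z‖ ^ 2 • comb z e (frameNum t m b a x y) := by
  simp only [christoffelNum, hf.inner_eq, twist_real_mul, frameNum, comb_add, comb_sub, comb_smul,
    real_smul_eq]
  module

lemma IsFrame.curv_eq (hf : IsFrame z e) (u v w : ℂ × ℂ) :
    curv t m b z (comb z e u) (comb z e v) (comb z e w) = comb z e (frameCurv t m b u v w) := by
  have h0 : ‖z‖ ^ 2 ≠ 0 := pow_ne_zero 2 hf.pos.ne'
  have hz : ∀ x y, christoffelNum t m b z (comb z e x) (comb z e y) =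
      ‖z‖ ^ 2 • comb z e (frameNum t m b (1, 0) x y) := fun x y => by
    rw [← hf.christoffelNum_eq, comb_one_zero]
  have hre : ∀ x : ℂ × ℂ, (inner ℂ z (comb z e x) : ℂ).re = ‖z‖ ^ 2 * x.1.re := fun x => by
    have := hf.inner_eq (1, 0) x
    rw [comb_one_zero] at this
    rw [this, Complex.re_ofReal_mul]
    simp [herm]
  simp only [curv, hf.christoffelNum_eq, hz, christoffelNum_smul₃, hre, frameCurv, comb_add,
    comb_sub, comb_real_smul]
  generalize ‖z‖ ^ 2 = h at h0
  match_scalars <;> field_simp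

/-- The numerator `⟨R(u, iu)u, iu⟩` of the holomorphic sectional curvature. The relation
`t = m + b - 1` holds for all the connections `D^r_s`; thanks to it the right-hand side is a
multiple of `|u₂|² |u|²`. -/
lemma herm_frameCurv_self (hmb : t = m + b - 1) (u : ℂ × ℂ) :
    (herm (frameCurv t m b u (Complex.I • u) u) (Complex.I • u)).re =
      (m ^ 2 + b ^ 2 - 2) * Complex.normSq u.2 * (Complex.normSq u.1 + Complex.normSq u.2) := by
  obtain ⟨⟨a, a'⟩, ⟨d, d'⟩⟩ := u
  subst hmb
  simp [frameCurv, frameNum, herm, twist, Complex.normSq_apply]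
  ring

/-- A component of the curvature which, with `frameCurv_radial_I`, decides about flatness. -/
lemma frameCurv_radial (hmb : t = m + b - 1) :
    frameCurv t m b (Complex.I, 0) (0, 1) (0, 1) = ((m + b) * (1 - b) * Complex.I, 0) := by
  subst hmb
  refine Prod.ext (Complex.ext ?_ ?_) (Complex.ext ?_ ?_) <;>
    simp [frameCurv, frameNum, herm, twist]
  ring

lemma frameCurv_radial_I (hmb : t = m + b - 1) :
    frameCurv t m b (Complex.I, 0) (0, 1) (0, Complex.I) = ((m + b : ℂ) * (m - 1), 0) := by
  subst hmb
  refine Prod.ext (Complex.ext ?_ ?_) (Complex.ext ?_ ?_) <;>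
    simp [frameCurv, frameNum, herm, twist]
  ring

/-- The three flat members in dimension two: `∇ᵇ`, here, and `∇⁺`, `∇⁻` below. -/
lemma frameCurv_one_one (u v w : ℂ × ℂ) : frameCurv 1 1 1 u v w = 0 := by
  obtain ⟨⟨a, a'⟩, ⟨d, d'⟩⟩ := u
  obtain ⟨⟨x, x'⟩, ⟨y, y'⟩⟩ := v
  obtain ⟨⟨p, p'⟩, ⟨q, q'⟩⟩ := w
  refine Prod.ext (Complex.ext ?_ ?_) (Complex.ext ?_ ?_) <;>
    simp [frameCurv, frameNum, herm, twist] <;> ring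

lemma frameCurv_one_neg_one (u v w : ℂ × ℂ) : frameCurv (-1) 1 (-1) u v w = 0 := by
  obtain ⟨⟨a, a'⟩, ⟨d, d'⟩⟩ := u
  obtain ⟨⟨x, x'⟩, ⟨y, y'⟩⟩ := v
  obtain ⟨⟨p, p'⟩, ⟨q, q'⟩⟩ := w
  refine Prod.ext (Complex.ext ?_ ?_) (Complex.ext ?_ ?_) <;>
    simp [frameCurv, frameNum, herm, twist] <;> ring

lemma frameCurv_neg_one_one (u v w : ℂ × ℂ) : frameCurv (-1) (-1) 1 u v w = 0 := by
  obtain ⟨⟨a, a'⟩, ⟨d, d'⟩⟩ := u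
  obtain ⟨⟨x, x'⟩, ⟨y, y'⟩⟩ := v
  obtain ⟨⟨p, p'⟩, ⟨q, q'⟩⟩ := w
  refine Prod.ext (Complex.ext ?_ ?_) (Complex.ext ?_ ?_) <;>
    simp [frameCurv, frameNum, herm, twist] <;> ring

/-- The component of the curvature on a vector orthogonal to the frame, which only exists from
dimension three on. -/
lemma curv_orthogonal (t m b : ℝ) {z e f : Cn n} (hf : IsFrame z e) (hzf : inner ℂ z f = (0 : ℂ))
    (hef : inner ℂ e f = (0 : ℂ)) :
    curv t m b z e (Complex.I • e) f = (2 * t * Complex.I : ℂ) • f := by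
  have h1 : inner ℂ e z = (0 : ℂ) := inner_eq_zero_symm.1 hf.orth
  have h0 : (‖z‖ : ℂ) ≠ 0 := by exact_mod_cast hf.pos.ne'
  have he : ‖z‖ ^ 2 ≠ 0 := pow_ne_zero 2 hf.pos.ne'
  have k1 : twist (-1) t (((‖z‖ ^ 2 : ℝ) : ℂ) * Complex.I) =
      ((‖z‖ ^ 2 : ℝ) : ℂ) * (t * Complex.I) := by
    rw [twist_real_mul]; congr 1; apply Complex.ext <;> simp [twist]
  have k2 : twist (-1) t (-(((‖z‖ ^ 2 : ℝ) : ℂ) * Complex.I)) =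
      -((‖z‖ ^ 2 : ℝ) : ℂ) * (t * Complex.I) := by
    rw [neg_mul_eq_mul_neg, twist_real_mul, neg_mul_comm]
    congr 1
    apply Complex.ext <;> simp [twist]
  have k0 : ∀ k l, twist k l 0 = 0 := fun k l => by apply Complex.ext <;> simp [twist]
  have e1 : inner ℂ e (Complex.I • e) = ((‖z‖ ^ 2 : ℝ) : ℂ) * Complex.I := by
    rw [inner_smul_right, inner_self_eq_norm_sq_to_K, hf.norm_eq]; push_cast; ring_nf; rfl
  have e2 : inner ℂ (Complex.I • e) e = -(((‖z‖ ^ 2 : ℝ) : ℂ) * Complex.I) := by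
    rw [inner_smul_left, inner_self_eq_norm_sq_to_K, hf.norm_eq]; push_cast; simp; ring
  have e3 : inner ℂ z (Complex.I • e) = (0 : ℂ) := by rw [inner_smul_right, hf.orth, mul_zero]
  have e4 : inner ℂ (Complex.I • e) f = (0 : ℂ) := by rw [inner_smul_left, hef, mul_zero]
  have e5 : christoffelNum t m b z e f = 0 := by simp [christoffelNum, hf.orth, hzf, hef, k0]
  have e6 : christoffelNum t m b z (Complex.I • e) f = 0 := by
    simp [christoffelNum, e3, hzf, e4, k0]
  have e7 : ∀ X, christoffelNum t m b z X 0 = 0 := fun X => by simp [christoffelNum, k0]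
  have e8 : christoffelNum t m b e (Complex.I • e) f =
      (((‖z‖ ^ 2 : ℝ) : ℂ) * (t * Complex.I)) • f := by
    simp only [christoffelNum, e1, hef, e4, k0, k1]; module
  have e9 : christoffelNum t m b (Complex.I • e) e f =
      (-((‖z‖ ^ 2 : ℝ) : ℂ) * (t * Complex.I)) • f := by
    simp only [christoffelNum, e2, hef, e4, k0, k2]; module
  simp only [curv, e5, e6, e7, e8, e9, real_smul_eq]
  match_scalars
  field_simp
  ring

end HopfAlgebra

/-! ### Invariance properties of the Christoffel symbols -/

namespace HopfAlgebra

variable {n : ℕ} (t m b : ℝ)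

lemma christoffelNum_I_smul₃ (z X Y : Cn n) :
    christoffelNum t m m z X (Complex.I • Y) = Complex.I • christoffelNum t m m z X Y := by
  have h : ∀ c : ℂ, twist m m (Complex.I * c) = Complex.I * twist m m c := fun c => by
    apply Complex.ext <;> simp [twist]
  simp only [christoffelNum, inner_smul_right, h]
  module

/-- For `m = b` the Christoffel symbols are complex linear in the differentiated field. -/
lemma christoffel_I_smul (z X Y : Cn n) :
    christoffel t m m z X (Complex.I • Y) = Complex.I • christoffel t m m z X Y := by
  simp only [christoffel, christoffelNum_I_smul₃, smul_comm _ Complex.I]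

/-- The Hermitian form is scaled by `A.lin ^ k`. The imaginary part is the real part for
`i v`. -/
lemma inner_lin_zpow_complex (A : HopfMultiplier n) (k : ℤ) (v w : Cn n) :
    inner ℂ ((A.lin ^ k) v) ((A.lin ^ k) w) = (((A.ρ ^ k) ^ 2 : ℝ) : ℂ) * inner ℂ v w := by
  have hre : ∀ v w : Cn n, (inner ℂ ((A.lin ^ k) v) ((A.lin ^ k) w) : ℂ).re =
      (A.ρ ^ k) ^ 2 * (inner ℂ v w : ℂ).re := fun v w => by
    rw [← HopfMultiplier.real_inner, ← HopfMultiplier.real_inner, A.inner_lin_zpow]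
  have him := hre (Complex.I • v) w
  rw [map_smul, inner_smul_left, inner_smul_left] at him
  refine Complex.ext ?_ ?_
  · rw [hre, Complex.re_ofReal_mul]
  · rw [Complex.im_ofReal_mul]
    simpa using him

lemma christoffelNum_lin (A : HopfMultiplier n) (k : ℤ) (z X Y : Cn n) :
    christoffelNum t m b ((A.lin ^ k) z) ((A.lin ^ k) X) ((A.lin ^ k) Y) =
      (A.ρ ^ k) ^ 2 • (A.lin ^ k) (christoffelNum t m b z X Y) := by
  simp only [christoffelNum, inner_lin_zpow_complex, twist_real_mul, map_add, map_sub, map_smul,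
    real_smul_eq]
  module

/-- The Christoffel symbols are invariant under the linear maps `A.lin ^ k`, hence descend to the
Hopf manifold. -/
lemma christoffel_lin (A : HopfMultiplier n) (k : ℤ) (z X Y : Cn n) :
    christoffel t m b ((A.lin ^ k) z) ((A.lin ^ k) X) ((A.lin ^ k) Y) =
      (A.lin ^ k) (christoffel t m b z X Y) := by
  have h : (A.ρ ^ k) ^ 2 ≠ 0 := pow_ne_zero 2 (zpow_pos A.pos k).ne'
  rw [christoffel, christoffelNum_lin, A.norm_lin_zpow, mul_pow, christoffel, real_smul_eq,
    real_smul_eq, real_smul_eq, map_smul, smul_smul]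
  congr 1
  rw [← Complex.ofReal_mul]
  congr 1
  rw [mul_inv, mul_right_comm, inv_mul_cancel₀ h, one_mul]

/-- The infinitesimal form of the compatibility with the metric `2 Re ⟨·, ·⟩ / |z|²`. -/
lemma inner_christoffel (z X Y W : Cn n) :
    inner ℝ (christoffel t m b z X Y) W + inner ℝ Y (christoffel t m b z X W) =
      -(2 * inner ℝ z X * (‖z‖ ^ 2)⁻¹ * inner ℝ Y W) := by
  have hr : ∀ (r : ℝ) (v w : Cn n), (inner ℂ (r • v) w : ℂ).re = r * (inner ℂ v w : ℂ).re := by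
    intro r v w
    rw [real_smul_eq, inner_smul_left, Complex.conj_ofReal, Complex.re_ofReal_mul]
  have hr' : ∀ (r : ℝ) (v w : Cn n), (inner ℂ v (r • w) : ℂ).re = r * (inner ℂ v w : ℂ).re := by
    intro r v w
    rw [real_smul_eq, inner_smul_right, Complex.re_ofReal_mul]
  simp only [christoffel, HopfMultiplier.real_inner, hr, hr']
  have h : (inner ℂ (christoffelNum t m b z X Y) W : ℂ).re +
      (inner ℂ Y (christoffelNum t m b z X W) : ℂ).re =
      -(2 * (inner ℂ z X : ℂ).re * (inner ℂ Y W : ℂ).re) := by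
    simp only [christoffelNum, inner_add_left, inner_sub_left, inner_add_right, inner_sub_right,
      inner_smul_left, inner_smul_right]
    rw [← inner_conj_symm (𝕜 := ℂ) Y z, ← inner_conj_symm (𝕜 := ℂ) Y X]
    generalize (inner ℂ z X : ℂ) = c1
    generalize (inner ℂ z Y : ℂ) = c2
    generalize (inner ℂ X Y : ℂ) = c3
    generalize (inner ℂ z W : ℂ) = c4
    generalize (inner ℂ X W : ℂ) = c5
    generalize (inner ℂ Y W : ℂ) = c6
    simp [twist]
    ring
  linear_combination (‖z‖ ^ 2)⁻¹ * h

end HopfAlgebra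

/-! ### The family of connections on the Hopf manifold and its curvature -/

namespace HopfMultiplier
open HopfAlgebra

variable {n : ℕ} (A : HopfMultiplier n)

/-- The flat connection of the affine structure of the Hopf manifold: it differentiates the
coordinates of a field in the preferred chart at the point of evaluation. -/
def flatConnection : AffineConnection 𝓘(ℝ, Cn n) A.HopfManifold where
  toFun Y x := (mvfderiv 𝓘(ℝ, Cn n) (fun y => A.coord x y (Y y)) x :)
  isCovariantDerivativeOnUniv :=
    { add := fun {Y Y' x} hY hY' _ => by
        have e : (fun y => A.coord x y (Y y)) + (fun y => A.coord x y (Y' y)) =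
            fun y => A.coord x y ((Y + Y') y) := by
          funext y; exact (map_add _ _ _).symm
        have h := mvfderiv_add (diffFieldAt_iff_self.1 hY) (diffFieldAt_iff_self.1 hY')
        rw [e] at h
        exact h
      leibniz := fun {Y f x} hY hf _ => by
        have e : f • (fun y => A.coord x y (Y y)) = fun y => A.coord x y ((f • Y) y) := by
          funext y; exact ((A.coord x y).map_smul _ _).symm
        have h := mvfderiv_smul hf (diffFieldAt_iff_self.1 hY)
        rw [e, coord_self] at h
        exact h }

/-- The connection with the Christoffel symbols `christoffel t m b`. The Levi-Civita, Chern and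
Bismut connections have the parameters `(0, 1, 0)`, `(-1, 0, 0)` and `(1, 1, 1)`. -/
def hopfConnection (t m b : ℝ) : AffineConnection 𝓘(ℝ, Cn n) A.HopfManifold :=
  A.flatConnection.addOneForm fun x => christoffelL t m b (chartAt (Cn n) x x)

variable {A} (t m b : ℝ)

lemma hopfConnection_apply (Y : Π y : A.HopfManifold, TangentSpace 𝓘(ℝ, Cn n) y)
    (x : A.HopfManifold) (v : TangentSpace 𝓘(ℝ, Cn n) x) :
    A.hopfConnection t m b Y x v =
      mvfderiv 𝓘(ℝ, Cn n) (fun y => A.coord x y (Y y)) x v +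
        christoffel t m b (chartAt (Cn n) x x) v (Y x) := rfl

lemma diffFieldAt_extend (x : A.HopfManifold) (v : TangentSpace 𝓘(ℝ, Cn n) x) :
    AffineConnection.DiffFieldAt (FiberBundle.extend (Cn n) v) x :=
  FiberBundle.mdifferentiableAt_extend 𝓘(ℝ, Cn n) (Cn n) v

lemma mvfderiv_of_hasMFDerivAt {F : Type*} [NormedAddCommGroup F] [NormedSpace ℝ F]
    {x : A.HopfManifold} {f : A.HopfManifold → F} {T : Cn n →L[ℝ] F}
    (h : HasMFDerivAt 𝓘(ℝ, Cn n) 𝓘(ℝ, F) f x T) : mvfderiv 𝓘(ℝ, Cn n) f x = T := by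
  unfold mvfderiv
  rw [h.mfderiv]
  rfl

/-- The field extending `v` is differentiable and parallel for `flatConnection`, not only at `x` but
in a neighbourhood. -/
lemma flatConnection_extend {x : A.HopfManifold} (v : TangentSpace 𝓘(ℝ, Cn n) x) :
    ∀ᶠ y in nhds x, AffineConnection.DiffFieldAt (FiberBundle.extend (Cn n) v) y ∧
      mvfderiv 𝓘(ℝ, Cn n) (fun y' => A.coord y y' (FiberBundle.extend (Cn n) v y')) y
        = 0 := by
  filter_upwards [(chartAt (Cn n) x).open_source.mem_nhds (mem_chart_source (Cn n) x)] with y hy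
  obtain ⟨k, hk⟩ := transition hy
  have h : (fun y' => A.coord y y' (FiberBundle.extend (Cn n) v y')) =ᶠ[nhds y]
      fun _ => (A.lin ^ k) (v : Cn n) := by
    filter_upwards [hk, (chartAt (Cn n) x).open_source.mem_nhds hy] with y' h1 h2
    rw [h1.2, coord_extend h2]
  have hd : HasMFDerivAt 𝓘(ℝ, Cn n) 𝓘(ℝ, Cn n)
      (fun y' => A.coord y y' (FiberBundle.extend (Cn n) v y')) y
      (0 : Cn n →L[ℝ] Cn n) :=
    (hasMFDerivAt_const ((A.lin ^ k) (v : Cn n)) y).congr_of_eventuallyEq h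
  exact ⟨diffFieldAt_iff_self.2 hd.mdifferentiableAt, mvfderiv_of_hasMFDerivAt hd⟩

/-- The covariant derivative of a field with constant coordinates along another one, as a function
near `x` in the chart at `x`. -/
lemma hopfConnection_extend (x : A.HopfManifold) (w : TangentSpace 𝓘(ℝ, Cn n) x) :
    ∀ᶠ y in nhds x, ∀ v : TangentSpace 𝓘(ℝ, Cn n) x,
      A.coord x y (A.hopfConnection t m b (FiberBundle.extend (Cn n) w) y
        (FiberBundle.extend (Cn n) v y)) = christoffel t m b (chartAt (Cn n) x y) v w := by
  filter_upwards [(chartAt (Cn n) x).open_source.mem_nhds (mem_chart_source (Cn n) x),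
    flatConnection_extend w] with y hy hw v
  obtain ⟨k, hk, hk'⟩ := exists_coord hy
  refine (A.lin ^ k).injective ((hk' _).symm.trans ?_)
  rw [hopfConnection_apply, hw.2]
  refine (zero_add _).trans ?_
  have e : ∀ v : TangentSpace 𝓘(ℝ, Cn n) x,
      (FiberBundle.extend (Cn n) v y : Cn n) = (A.lin ^ k) v := fun v => by
    refine (hk' _).trans ?_
    rw [coord_extend hy]
  rw [hk, e, e]
  exact christoffel_lin t m b A k _ _ _

lemma hasMFDerivAt_comp_chart {F : Type*} [NormedAddCommGroup F] [NormedSpace ℝ F]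
    {x : A.HopfManifold} {f : Cn n → F} {T : Cn n →L[ℝ] F}
    (h : HasFDerivAt f T (chartAt (Cn n) x x)) :
    HasMFDerivAt 𝓘(ℝ, Cn n) 𝓘(ℝ, F) (fun y : A.HopfManifold => f (chartAt (Cn n) x y)) x T :=
  h.hasMFDerivAt.comp x (mfderiv_chart x)

/-- The curvature of `hopfConnection`. It can be computed with fields of constant coordinates, whose
brackets vanish. -/
lemma curvature_hopfConnection (x : A.HopfManifold) (u v w : TangentSpace 𝓘(ℝ, Cn n) x) :
    (A.hopfConnection t m b).curvature x u v w = curv t m b (chartAt (Cn n) x x) u v w := by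
  have key : ∀ v u : TangentSpace 𝓘(ℝ, Cn n) x, ∃ T : Cn n →L[ℝ] Cn n,
      A.hopfConnection t m b (fun y => A.hopfConnection t m b (FiberBundle.extend (Cn n) w) y
        (FiberBundle.extend (Cn n) v y)) x u = T u + christoffel t m b (chartAt (Cn n) x x) u
          (christoffel t m b (chartAt (Cn n) x x) v w) ∧
      T u = (‖chartAt (Cn n) x x‖ ^ 2)⁻¹ • christoffelNum t m b u v w
        - (2 * ((‖chartAt (Cn n) x x‖ ^ 2)⁻¹) ^ 2 *
            (inner ℂ (chartAt (Cn n) x x) (u : Cn n) : ℂ).re) •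
          christoffelNum t m b (chartAt (Cn n) x x) v w := by
    intro v u
    obtain ⟨T, hT, hT'⟩ := hasFDerivAt_christoffel t m b (chart_ne (A := A) (x := x) (y := x)) v w
    refine ⟨T, ?_, hT' u⟩
    have hev := hopfConnection_extend t m b x w
    have h1 := (hasMFDerivAt_comp_chart hT).congr_of_eventuallyEq
      (hev.mono fun y hy => hy v)
    rw [hopfConnection_apply, mvfderiv_of_hasMFDerivAt h1]
    have h2 := hev.self_of_nhds v
    rw [coord_self] at h2
    rw [h2]
    rfl
  obtain ⟨Tv, h1, h1'⟩ := key v u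
  obtain ⟨Tu, h2, h2'⟩ := key u v
  rw [← curv_eq_of_deriv t m b h1' h2']
  unfold AffineConnection.curvature AffineConnection.curvatureField
  rw [mlieBracket_extend, map_zero, sub_zero, FiberBundle.extend_apply_self,
    FiberBundle.extend_apply_self, h1, h2]
  exact add_sub_add_comm (α := Cn n) _ _ _ _

end HopfMultiplier

/-! ### Vanishing of tensors with the symmetries of a difference of connections -/

namespace HopfAlgebra
variable {n : ℕ}

lemma inner_I_smul_left (v w : Cn n) :
    inner ℝ (Complex.I • v) w = -inner ℝ v (Complex.I • w) := by
  simp [HopfMultiplier.real_inner]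

lemma inner_I_smul_I_smul (v w : Cn n) :
    inner ℝ (Complex.I • v) (Complex.I • w) = inner ℝ v w := by
  rw [inner_I_smul_left, smul_smul, Complex.I_mul_I]
  simp

/-- The difference tensor of two Levi-Civita connections vanishes. Here and in the next two lemmas
`S Y X` stands for `D_X Y - D'_X Y`, and `skew` says that both connections are metric. -/
lemma eq_zero_of_skew_of_symm {S : Cn n → Cn n → Cn n}
    (skew : ∀ X Y W, inner ℝ (S Y X) W + inner ℝ Y (S W X) = 0)
    (symm : ∀ X Y, S Y X = S X Y) (X Y : Cn n) : S Y X = 0 := by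
  refine ext_inner_right ℝ fun W => ?_
  rw [inner_zero_left]
  have h1 := skew X Y W
  have h2 := skew Y W X
  have h3 := skew W X Y
  rw [real_inner_comm] at h1 h2 h3
  rw [real_inner_comm] at h1 h2 h3
  rw [real_inner_comm (S W X) Y] at h1
  rw [real_inner_comm (S X Y) W] at h2
  rw [real_inner_comm (S Y W) X] at h3
  rw [symm X Y] at h1 ⊢
  rw [symm Y W] at h2
  rw [symm W X] at h3
  linarith

/-- The difference tensor of two Chern connections vanishes: the torsion condition gives
`S Y (J X) = J (S Y X)`. As a map of `Y` this is skew-adjoint, but also self-adjoint, being the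
product of the commuting skew-adjoint maps `J` and `Y ↦ S Y X`. -/
lemma eq_zero_of_skew_of_chern {S : Cn n → Cn n → Cn n}
    (neg : ∀ X Y, S Y (-X) = -S Y X)
    (skew : ∀ X Y W, inner ℝ (S Y X) W + inner ℝ Y (S W X) = 0)
    (hJ : ∀ X Y, S (Complex.I • Y) X = Complex.I • S Y X)
    (hT : ∀ X Y, S (Complex.I • Y) (Complex.I • X) - S (Complex.I • X) (Complex.I • Y) =
      -(S Y X - S X Y)) (X Y : Cn n) : S Y X = 0 := by
  have hI : ∀ v : Cn n, Complex.I • Complex.I • v = -v := fun v => by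
    rw [smul_smul, Complex.I_mul_I, neg_one_smul]
  have hI0 : ∀ v : Cn n, v + v = 0 → v = 0 := fun v h => by
    have : (2 : ℂ) • v = 0 := by rw [two_smul, h]
    simpa using this
  -- the condition on the torsion: `S Y X + J S Y (J X)` is symmetric
  have hB : ∀ X Y, S Y X + Complex.I • S Y (Complex.I • X) =
      S X Y + Complex.I • S X (Complex.I • Y) := fun X Y => by
    have := hT X Y
    rw [hJ, hJ] at this
    linear_combination (norm := module) (1 : ℂ) • this
  have hC : ∀ X Y, S Y (Complex.I • X) = Complex.I • S Y X := fun X Y => by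
    have h1 := hB (Complex.I • X) Y
    have h2 := hB X Y
    rw [hI, neg, hJ, hJ, smul_neg] at h1
    have h3 : S Y (Complex.I • X) - Complex.I • S Y X =
        Complex.I • (S X Y + Complex.I • S X (Complex.I • Y)) := by
      rw [smul_add, ← h1]; module
    rw [← h2, smul_add, hI] at h3
    rw [← sub_eq_zero]
    apply hI0
    linear_combination (norm := module) (1 : ℂ) • h3
  have h0 : Complex.I • S Y X = 0 := by
    refine ext_inner_right ℝ fun W => ?_
    rw [inner_zero_left]
    have h1 := skew (Complex.I • X) Y W
    have h2 := skew X (Complex.I • Y) W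
    rw [hC, hC] at h1
    rw [hJ, inner_I_smul_left Y] at h2
    linarith
  simpa using h0

/-- The difference tensor of two Bismut connections vanishes: `⟨S Y X, W⟩` is totally skew and
invariant under `J` on any two of its arguments; applying `J` to the three pairs in turn replaces it
by its negative. -/
lemma eq_zero_of_skew_of_bismut {S : Cn n → Cn n → Cn n}
    (skew : ∀ X Y W, inner ℝ (S Y X) W + inner ℝ Y (S W X) = 0)
    (hJ : ∀ X Y, S (Complex.I • Y) X = Complex.I • S Y X)
    (hT : ∀ X Y W, inner ℝ (S Y X - S X Y) W = -inner ℝ (S W X - S X W) Y)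
    (X Y : Cn n) : S Y X = 0 := by
  have h1 : ∀ X Y W, inner ℝ (S Y X) W = -inner ℝ (S W X) Y := fun X Y W => by
    have := skew X Y W
    rw [real_inner_comm (S W X)] at this
    linarith
  have h2 : ∀ X Y W, inner ℝ (S X Y) W = -inner ℝ (S Y X) W := fun X Y W => by
    have e1 := hT W Y X
    rw [inner_sub_left, inner_sub_left] at e1
    have e2 := h1 W X Y
    have e3 := h1 Y X W
    have e4 := h1 X Y W
    linarith
  have h3 : ∀ X Y W, inner ℝ (S (Complex.I • Y) X) (Complex.I • W) = inner ℝ (S Y X) W :=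
    fun X Y W => by rw [hJ, inner_I_smul_I_smul]
  refine ext_inner_right ℝ fun W => ?_
  rw [inner_zero_left]
  have e1 := h3 X Y W
  have e2 := h2 X (Complex.I • Y) (Complex.I • W)
  have e3 := h3 (Complex.I • Y) X (Complex.I • W)
  rw [smul_smul, Complex.I_mul_I, neg_one_smul, inner_neg_right] at e3
  have e4 := h1 (Complex.I • Y) (Complex.I • X) W
  have e5 := h2 W (Complex.I • Y) (Complex.I • X)
  have e6 := h3 W Y X
  have e7 := h2 Y W X
  have e8 := h1 Y X W
  have e9 := h2 X Y W
  linarith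

end HopfAlgebra

/-! ### Metric, complex structure and torsion -/

namespace HopfMultiplier
open HopfAlgebra

variable {n : ℕ} {A : HopfMultiplier n} (t m b : ℝ)

lemma metric_apply (y : A.HopfManifold) (v w : TangentSpace 𝓘(ℝ, Cn n) y) :
    A.metric.inner y v w = 2 / ‖chartAt (Cn n) y y‖ ^ 2 * @inner ℝ (Cn n) _ v w := rfl

/-- The metric in the coordinates of the preferred chart at `x`. -/
lemma metric_eq_coord {x y : A.HopfManifold} (hy : y ∈ (chartAt (Cn n) x).source)
    (v w : TangentSpace 𝓘(ℝ, Cn n) y) :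
    A.metric.inner y v w =
      2 / ‖chartAt (Cn n) x y‖ ^ 2 * inner ℝ (A.coord x y v) (A.coord x y w) := by
  obtain ⟨k, hk, hk'⟩ := exists_coord hy
  have e : @inner ℝ (Cn n) _ v w = inner ℝ ((A.lin ^ k) (A.coord x y v))
      ((A.lin ^ k) (A.coord x y w)) := congrArg₂ (fun a c : Cn n => inner ℝ a c) (hk' v) (hk' w)
  rw [metric_apply, e, hk, inner_lin_zpow, norm_lin_zpow]
  have hp := zpow_pos A.pos k
  have := norm_pos_iff.2 (chart_ne (A := A) (x := x) (y := y))
  field_simp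

lemma hasMFDerivAt_inner {x : A.HopfManifold} {f g : A.HopfManifold → Cn n}
    {f' g' : Cn n →L[ℝ] Cn n} (hf : HasMFDerivAt 𝓘(ℝ, Cn n) 𝓘(ℝ, Cn n) f x f')
    (hg : HasMFDerivAt 𝓘(ℝ, Cn n) 𝓘(ℝ, Cn n) g x g') :
    HasMFDerivAt 𝓘(ℝ, Cn n) 𝓘(ℝ, ℝ) (fun y => inner ℝ (f y) (g y)) x
      ((fderivInnerCLM ℝ (f x, g x)).comp (f'.prod g')) := by
  have hf1 : ContinuousAt f x := hf.1
  have hg1 : ContinuousAt g x := hg.1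
  refine ⟨Filter.Tendsto.inner hf1 hg1, ?_⟩
  have h1 := hf.2
  have h2 := hg.2
  have := HasFDerivWithinAt.inner ℝ h1 h2
  simp only [writtenInExtChartAt, mfld_simps] at this ⊢
  exact this

lemma hasFDerivAt_metric_coeff {z : Cn n} (hz : z ≠ 0) :
    ∃ T : Cn n →L[ℝ] ℝ, HasFDerivAt (fun z : Cn n => 2 / ‖z‖ ^ 2) T z ∧
      ∀ v, T v = -(4 * ((‖z‖ ^ 2)⁻¹) ^ 2 * inner ℝ z v) := by
  have h0 : ‖z‖ ^ 2 ≠ 0 := pow_ne_zero 2 (norm_ne_zero_iff.2 hz)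
  have h1 : HasFDerivAt (fun z : Cn n => ‖z‖ ^ 2) (2 • innerSL ℝ z) z :=
    (hasStrictFDerivAt_norm_sq z).hasFDerivAt
  have h2 := ((hasDerivAt_inv h0).comp_hasFDerivAt z h1).const_mul (2 : ℝ)
  refine ⟨_, h2, fun v => ?_⟩
  simp
  ring

lemma hasMFDerivAt_mvfderiv {x : A.HopfManifold} {f : A.HopfManifold → Cn n}
    (hf : MDifferentiableAt 𝓘(ℝ, Cn n) 𝓘(ℝ, Cn n) f x) :
    ∃ F : Cn n →L[ℝ] Cn n, HasMFDerivAt 𝓘(ℝ, Cn n) 𝓘(ℝ, Cn n) f x F ∧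
      mvfderiv 𝓘(ℝ, Cn n) f x = F :=
  ⟨_, hf.hasMFDerivAt, rfl⟩

lemma mvfderiv_congr {F : Type*} [NormedAddCommGroup F] [NormedSpace ℝ F]
    {x : A.HopfManifold} {f g : A.HopfManifold → F} (h : f =ᶠ[nhds x] g) :
    mvfderiv 𝓘(ℝ, Cn n) f x = mvfderiv 𝓘(ℝ, Cn n) g x := by
  ext v
  have := h.mfderiv_eq (I := 𝓘(ℝ, Cn n)) (I' := 𝓘(ℝ, F))
  exact congrArg (fun T : Cn n →L[ℝ] F => T v) this

theorem hopfConnection_isMetric : (A.hopfConnection t m b).IsMetric A.metric := by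
  intro x X Y hX hY v
  obtain ⟨T, hT, hT'⟩ := hasFDerivAt_metric_coeff (chart_ne (A := A) (x := x) (y := x))
  obtain ⟨F, hX', hF⟩ := hasMFDerivAt_mvfderiv (diffFieldAt_iff_self.1 hX)
  obtain ⟨G, hY', hG⟩ := hasMFDerivAt_mvfderiv (diffFieldAt_iff_self.1 hY)
  have h1 := hasMFDerivAt_comp_chart hT
  have h2 := hasMFDerivAt_inner hX' hY'
  have hev : (fun y => A.metric.inner y (X y) (Y y)) =ᶠ[nhds x]
      ((fun y => 2 / ‖chartAt (Cn n) x y‖ ^ 2) *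
      fun y => inner ℝ (A.coord x y (X y)) (A.coord x y (Y y))) := by
    filter_upwards [(chartAt (Cn n) x).open_source.mem_nhds (mem_chart_source (Cn n) x)] with y hy
    exact metric_eq_coord hy _ _
  have h3 := mvfderiv_congr hev
  rw [mvfderiv_mul h1.mdifferentiableAt h2.mdifferentiableAt, mvfderiv_of_hasMFDerivAt h1,
    mvfderiv_of_hasMFDerivAt h2, coord_self, coord_self] at h3
  refine (DFunLike.congr_fun h3 v).trans ?_
  rw [hopfConnection_apply, hopfConnection_apply, hF, hG]
  have h4 : ∀ X Y v : Cn n,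
      2 / ‖chartAt (Cn n) x x‖ ^ 2 * (inner ℝ X (G v) + inner ℝ (F v) Y) + inner ℝ X Y * T v =
      2 / ‖chartAt (Cn n) x x‖ ^ 2 *
          inner ℝ (F v + christoffel t m b (chartAt (Cn n) x x) v X) Y +
        2 / ‖chartAt (Cn n) x x‖ ^ 2 *
          inner ℝ X (G v + christoffel t m b (chartAt (Cn n) x x) v Y) := by
    intro X Y v
    have h4 := inner_christoffel t m b (chartAt (Cn n) x x) v X Y
    rw [hT', inner_add_left, inner_add_right]
    linear_combination (-2 / ‖chartAt (Cn n) x x‖ ^ 2) * h4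
  exact h4 (X x) (Y x) v

lemma coord_complexStructure {x y : A.HopfManifold} (hy : y ∈ (chartAt (Cn n) x).source)
    (v : TangentSpace 𝓘(ℝ, Cn n) y) :
    A.coord x y (A.complexStructure y v) = Complex.I • A.coord x y v := by
  obtain ⟨k, -, hk⟩ := exists_coord hy
  refine (A.lin ^ k).injective ((hk _).symm.trans ?_)
  rw [map_smul]
  exact congrArg (fun w : Cn n => Complex.I • w) (hk v)

/-- Two equal parameters `m = b` make the connection Hermitian. -/
theorem hopfConnection_preservesJ : (A.hopfConnection t m m).PreservesJ A.complexStructure := by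
  intro x X hX v
  obtain ⟨F, hX', hF⟩ := hasMFDerivAt_mvfderiv (diffFieldAt_iff_self.1 hX)
  set J : Cn n →L[ℝ] Cn n := (Complex.I • ContinuousLinearMap.id ℂ (Cn n)).restrictScalars ℝ
  have h1 := (J.hasMFDerivAt (x := A.coord x x (X x))).comp x hX'
  have h2 : HasMFDerivAt 𝓘(ℝ, Cn n) 𝓘(ℝ, Cn n)
      (fun y => A.coord x y (A.complexStructure y (X y))) x (J.comp F) := by
    refine h1.congr_of_eventuallyEq ?_
    filter_upwards [(chartAt (Cn n) x).open_source.mem_nhds (mem_chart_source (Cn n) x)] with y hy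
    exact coord_complexStructure hy _
  rw [hopfConnection_apply, hopfConnection_apply, hF, mvfderiv_of_hasMFDerivAt h2]
  have h3 : ∀ X v : Cn n, J (F v) + christoffel t m m (chartAt (Cn n) x x) v (J X) =
      J (F v + christoffel t m m (chartAt (Cn n) x x) v X) := fun X v => by
    rw [map_add]
    exact congrArg _ (christoffel_I_smul t m _ _ _)
  exact h3 (X x) v

lemma torsion_hopfConnection (x : A.HopfManifold) (u v : TangentSpace 𝓘(ℝ, Cn n) x) :
    (A.hopfConnection t m b).torsion x u v = christoffel t m b (chartAt (Cn n) x x) u v -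
      christoffel t m b (chartAt (Cn n) x x) v u := by
  rw [CovariantDerivative.torsion_apply_eq_extend, mlieBracket_extend, hopfConnection_apply,
    hopfConnection_apply, (flatConnection_extend u).self_of_nhds.2,
    (flatConnection_extend v).self_of_nhds.2, FiberBundle.extend_apply_self,
    FiberBundle.extend_apply_self]
  have h : ∀ p q : Cn n, (0 + p) - (0 + q) - 0 = p - q := fun p q => by simp
  exact h _ _

end HopfMultiplier

/-! ### The Levi-Civita, Chern and Bismut connections -/

namespace HopfAlgebra
variable {n : ℕ}

/-- The Christoffel symbols depend affinely on the parameters. -/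
lemma christoffel_affine (k₁ k₂ k₃ : ℝ) (hk : k₁ + k₂ + k₃ = 1)
    (t₁ m₁ b₁ t₂ m₂ b₂ t₃ m₃ b₃ : ℝ) (z X Y : Cn n) :
    christoffel (k₁ * t₁ + k₂ * t₂ + k₃ * t₃) (k₁ * m₁ + k₂ * m₂ + k₃ * m₃)
      (k₁ * b₁ + k₂ * b₂ + k₃ * b₃) z X Y =
      k₁ • christoffel t₁ m₁ b₁ z X Y + k₂ • christoffel t₂ m₂ b₂ z X Y
        + k₃ • christoffel t₃ m₃ b₃ z X Y := by
  have h : ∀ p₁ p₂ p₃ q₁ q₂ q₃ c, twist (k₁ * p₁ + k₂ * p₂ + k₃ * p₃)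
      (k₁ * q₁ + k₂ * q₂ + k₃ * q₃) c =
      k₁ * twist p₁ q₁ c + k₂ * twist p₂ q₂ c + k₃ * twist p₃ q₃ c := by
    intro p₁ p₂ p₃ q₁ q₂ q₃ c
    apply Complex.ext <;> simp [twist] <;> ring
  have h' := h (-1) (-1) (-1) t₁ t₂ t₃
  rw [show k₁ * -1 + k₂ * -1 + k₃ * -1 = -1 by linear_combination -hk] at h'
  simp only [christoffel, christoffelNum, h, h', real_smul_eq]
  module

end HopfAlgebra

namespace HopfMultiplier
open HopfAlgebra

variable {n : ℕ} {A : HopfMultiplier n} (t m b : ℝ)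

theorem hopfConnection_isLeviCivita : (A.hopfConnection 0 1 0).IsLeviCivita A.metric := by
  refine ⟨hopfConnection_isMetric _ _ _, fun x u v => ?_⟩
  rw [torsion_hopfConnection]
  have h : ∀ z u v : Cn n, christoffel 0 1 0 z u v - christoffel 0 1 0 z v u = 0 := by
    intro z u v
    have e : twist 1 0 (inner ℂ u v) = twist 1 0 (inner ℂ v u) := by
      rw [← inner_conj_symm u v]
      apply Complex.ext <;> simp only [twist, Complex.conj_re, one_mul, zero_mul]
    have e' : ∀ c, twist (-1) 0 c = -twist 1 0 c := fun c => by
      apply Complex.ext <;> simp [twist]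
    simp only [christoffel, christoffelNum, e, e']
    module
  exact h _ _ _

theorem hopfConnection_isChern :
    (A.hopfConnection (-1) 0 0).IsChern A.metric A.complexStructure := by
  refine ⟨hopfConnection_isMetric _ _ _, hopfConnection_preservesJ _ _, fun x u v => ?_⟩
  rw [torsion_hopfConnection, torsion_hopfConnection]
  have h : ∀ z u v : Cn n, christoffel (-1) 0 0 z (Complex.I • u) (Complex.I • v) -
      christoffel (-1) 0 0 z (Complex.I • v) (Complex.I • u) =
        -(christoffel (-1) 0 0 z u v - christoffel (-1) 0 0 z v u) := by
    intro z u v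
    have e' : ∀ c, twist (-1) (-1) c = -c := fun c => by
      apply Complex.ext <;> simp [twist]
    have e0 : ∀ c, twist 0 0 c = 0 := fun c => by
      apply Complex.ext <;> simp [twist]
    have hI : ∀ (c : ℂ) (v : Cn n), -(Complex.I * c) • Complex.I • v = c • v := fun c v => by
      rw [smul_smul]
      congr 1
      linear_combination -c * Complex.I_mul_I
    simp only [christoffel, christoffelNum, e0, e', inner_smul_right, hI]
    module
  exact h _ _ _

theorem hopfConnection_isBismut :
    (A.hopfConnection 1 1 1).IsBismut A.metric A.complexStructure := by
  refine ⟨hopfConnection_isMetric _ _ _, hopfConnection_preservesJ _ _, fun x u v w => ?_⟩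
  rw [torsion_hopfConnection, torsion_hopfConnection]
  have h : ∀ z u v w : Cn n, (inner ℝ (christoffel 1 1 1 z u v - christoffel 1 1 1 z v u) w : ℝ) =
        -inner ℝ (christoffel 1 1 1 z u w - christoffel 1 1 1 z w u) v := by
    intro z u v w
    have hr : ∀ (r : ℝ) (v w : Cn n), (inner ℂ (r • v) w : ℂ).re = r * (inner ℂ v w : ℂ).re := by
      intro r v w
      rw [real_smul_eq, inner_smul_left, Complex.conj_ofReal, Complex.re_ofReal_mul]
    simp only [christoffel, ← smul_sub, real_inner, hr]
    rw [← mul_neg]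
    congr 1
    simp only [christoffelNum, inner_add_left, inner_sub_left, inner_smul_left]
    rw [← inner_conj_symm (𝕜 := ℂ) v u, ← inner_conj_symm (𝕜 := ℂ) w u,
      ← inner_conj_symm (𝕜 := ℂ) w v]
    generalize (inner ℂ z u : ℂ) = c1
    generalize (inner ℂ z v : ℂ) = c2
    generalize (inner ℂ z w : ℂ) = c3
    generalize (inner ℂ u v : ℂ) = c4
    generalize (inner ℂ u w : ℂ) = c5
    generalize (inner ℂ v w : ℂ) = c6
    simp [twist]
    ring
  have hc : ∀ p q v w : Cn n, (inner ℝ p w : ℝ) = -inner ℝ q v →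
      2 / ‖chartAt (Cn n) x x‖ ^ 2 * inner ℝ p w =
        -(2 / ‖chartAt (Cn n) x x‖ ^ 2 * inner ℝ q v) := fun p q v w h => by
    rw [h, mul_neg]
  exact hc _ _ _ _ (h _ _ _ _)

/-- `S` is the difference tensor `S Y X = D_X Y - D'_X Y` of `D` and `D'` at `x`. -/
def IsDifference (D D' : AffineConnection 𝓘(ℝ, Cn n) A.HopfManifold) (x : A.HopfManifold)
    (S : TangentSpace 𝓘(ℝ, Cn n) x →L[ℝ] TangentSpace 𝓘(ℝ, Cn n) x →L[ℝ]
      TangentSpace 𝓘(ℝ, Cn n) x) : Prop :=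
  ∀ Y : Π y : A.HopfManifold, TangentSpace 𝓘(ℝ, Cn n) y, AffineConnection.DiffFieldAt Y x →
    ∀ v, D Y x v = D' Y x v + S (Y x) v

variable {D D' : AffineConnection 𝓘(ℝ, Cn n) A.HopfManifold} {x : A.HopfManifold}
  {S : TangentSpace 𝓘(ℝ, Cn n) x →L[ℝ] TangentSpace 𝓘(ℝ, Cn n) x →L[ℝ] TangentSpace 𝓘(ℝ, Cn n) x}

lemma exists_isDifference (D D' : AffineConnection 𝓘(ℝ, Cn n) A.HopfManifold)
    (x : A.HopfManifold) : ∃ S, IsDifference D D' x S := by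
  refine ⟨D.difference D' x, fun Y hY v => ?_⟩
  have h := IsCovariantDerivativeOn.difference_apply D.isCovariantDerivativeOnUniv
    D'.isCovariantDerivativeOnUniv (x := x) trivial hY
  have h2 := DFunLike.congr_fun h v
  refine ((add_sub_cancel (D' Y x v) (D Y x v)).symm.trans ?_)
  exact congrArg _ h2.symm

lemma IsDifference.skew (hS : IsDifference D D' x S) (h : D.IsMetric A.metric)
    (h' : D'.IsMetric A.metric) (X Y W : TangentSpace 𝓘(ℝ, Cn n) x) :
    @inner ℝ (Cn n) _ (S Y X) W + @inner ℝ (Cn n) _ Y (S W X) = 0 := by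
  have hY := diffFieldAt_extend x Y
  have hW := diffFieldAt_extend x W
  have h1 := (h x _ _ hY hW X).symm.trans (h' x _ _ hY hW X)
  rw [hS _ hY, hS _ hW, FiberBundle.extend_apply_self, FiberBundle.extend_apply_self] at h1
  have hc : (2 / ‖chartAt (Cn n) x x‖ ^ 2) ≠ 0 := (A.metric_coeff_pos x).ne'
  have h2 : ∀ Y W p q e f : Cn n, 2 / ‖chartAt (Cn n) x x‖ ^ 2 * inner ℝ (p + e) W +
      2 / ‖chartAt (Cn n) x x‖ ^ 2 * inner ℝ Y (q + f) =
      2 / ‖chartAt (Cn n) x x‖ ^ 2 * inner ℝ p W + 2 / ‖chartAt (Cn n) x x‖ ^ 2 * inner ℝ Y q →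
      inner ℝ e W + inner ℝ Y f = (0 : ℝ) := fun Y W p q e f h => by
    rw [inner_add_left, inner_add_right] at h
    refine (mul_eq_zero.1 ?_).resolve_left hc
    linear_combination h
  exact h2 _ _ _ _ _ _ h1

lemma IsDifference.torsion (hS : IsDifference D D' x S) (X Y : TangentSpace 𝓘(ℝ, Cn n) x) :
    D.torsion x X Y = D'.torsion x X Y + (S Y X - S X Y) := by
  have hX := diffFieldAt_extend x X
  have hY := diffFieldAt_extend x Y
  rw [CovariantDerivative.torsion_apply_eq_extend, CovariantDerivative.torsion_apply_eq_extend,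
    hS _ hX, hS _ hY, FiberBundle.extend_apply_self, FiberBundle.extend_apply_self]
  abel

lemma IsDifference.map_complexStructure (hS : IsDifference D D' x S)
    (h : D.PreservesJ A.complexStructure) (h' : D'.PreservesJ A.complexStructure)
    (X Y : TangentSpace 𝓘(ℝ, Cn n) x) :
    S (A.complexStructure x Y) X = A.complexStructure x (S Y X) := by
  have hY := diffFieldAt_extend x Y
  have hJY : AffineConnection.DiffFieldAt
      (fun y => A.complexStructure y (FiberBundle.extend (Cn n) Y y)) x := by
    refine diffFieldAt_iff_self.2 ?_
    let c : Cn n := A.complexStructure x Y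
    refine (mdifferentiableAt_const (c := c)).congr_of_eventuallyEq ?_
    filter_upwards [(chartAt (Cn n) x).open_source.mem_nhds (mem_chart_source (Cn n) x)] with y hy
    rw [coord_complexStructure hy, coord_extend hy]
    rfl
  have h1 := h x _ hY X
  have h2 := h' x _ hY X
  rw [hS _ hJY, hS _ hY, h2, FiberBundle.extend_apply_self, map_add] at h1
  exact add_left_cancel h1

variable {L C B : AffineConnection 𝓘(ℝ, Cn n) A.HopfManifold}
  {Y : Π y : A.HopfManifold, TangentSpace 𝓘(ℝ, Cn n) y}

theorem leviCivita_unique (hL : L.IsLeviCivita A.metric) (hY : AffineConnection.DiffFieldAt Y x)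
    (v : TangentSpace 𝓘(ℝ, Cn n) x) : L Y x v = A.hopfConnection 0 1 0 Y x v := by
  obtain ⟨S, hS⟩ := exists_isDifference L (A.hopfConnection 0 1 0) x
  have h0 : S (Y x) v = 0 := by
    refine eq_zero_of_skew_of_symm (S := fun Y X => S Y X)
      (hS.skew hL.1 hopfConnection_isLeviCivita.1)
      (fun (X Y : TangentSpace 𝓘(ℝ, Cn n) x) => ?_) _ _
    have h := hS.torsion X Y
    rw [hL.2, hopfConnection_isLeviCivita.2] at h
    rw [zero_add] at h
    exact sub_eq_zero.1 h.symm
  rw [hS Y hY, h0]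
  exact add_zero _

theorem chern_unique (hC : C.IsChern A.metric A.complexStructure)
    (hY : AffineConnection.DiffFieldAt Y x)
    (v : TangentSpace 𝓘(ℝ, Cn n) x) : C Y x v = A.hopfConnection (-1) 0 0 Y x v := by
  obtain ⟨S, hS⟩ := exists_isDifference C (A.hopfConnection (-1) 0 0) x
  have h0 : S (Y x) v = 0 := by
    refine eq_zero_of_skew_of_chern (S := fun Y X => S Y X) (fun X Y => map_neg _ _)
      (hS.skew hC.1 hopfConnection_isChern.1)
      (hS.map_complexStructure hC.2.1 hopfConnection_isChern.2.1)
      (fun (X Y : TangentSpace 𝓘(ℝ, Cn n) x) => ?_) _ _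
    have h1 := hS.torsion X Y
    have h2 := hS.torsion (A.complexStructure x X) (A.complexStructure x Y)
    rw [hC.2.2, hopfConnection_isChern.2.2, h1] at h2
    have h3 : ∀ p q r : Cn n, -(p + q) = -p + r → r = -q := fun p q r h => by
      rw [neg_add] at h; exact (add_left_cancel h).symm
    exact h3 _ _ _ h2
  rw [hS Y hY, h0]
  exact add_zero _

theorem bismut_unique (hB : B.IsBismut A.metric A.complexStructure)
    (hY : AffineConnection.DiffFieldAt Y x)
    (v : TangentSpace 𝓘(ℝ, Cn n) x) : B Y x v = A.hopfConnection 1 1 1 Y x v := by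
  obtain ⟨S, hS⟩ := exists_isDifference B (A.hopfConnection 1 1 1) x
  have h0 : S (Y x) v = 0 := by
    refine eq_zero_of_skew_of_bismut (S := fun Y X => S Y X)
      (hS.skew hB.1 hopfConnection_isBismut.1)
      (hS.map_complexStructure hB.2.1 hopfConnection_isBismut.2.1)
      (fun (X Y W : TangentSpace 𝓘(ℝ, Cn n) x) => ?_) _ _
    have h1 := hB.2.2 x X Y W
    have h2 := hopfConnection_isBismut.2.2 x X Y W
    rw [hS.torsion, hS.torsion] at h1
    have hc : (2 / ‖chartAt (Cn n) x x‖ ^ 2) ≠ 0 := (A.metric_coeff_pos x).ne'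
    have h3 : ∀ Y W p q r s : Cn n, 2 / ‖chartAt (Cn n) x x‖ ^ 2 * inner ℝ (p + r) W =
        -(2 / ‖chartAt (Cn n) x x‖ ^ 2 * inner ℝ (q + s) Y) →
        2 / ‖chartAt (Cn n) x x‖ ^ 2 * inner ℝ p W =
        -(2 / ‖chartAt (Cn n) x x‖ ^ 2 * inner ℝ q Y) → inner ℝ r W = -(inner ℝ s Y : ℝ) :=
      fun Y W p q r s h h' => by
        rw [inner_add_left, inner_add_left] at h
        refine mul_left_cancel₀ hc ?_
        linear_combination h - h'
    exact h3 _ _ _ _ _ _ h1 h2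
  rw [hS Y hY, h0]
  exact add_zero _

/-- All the connections `D^r_s` belong to the family, with parameters satisfying `t = m + b - 1`.
Only their action on differentiable fields is determined. -/
theorem canonical_eq (hL : L.IsLeviCivita A.metric) (hC : C.IsChern A.metric A.complexStructure)
    (hB : B.IsBismut A.metric A.complexStructure) (r s : ℝ)
    (hY : AffineConnection.DiffFieldAt Y x) (v : TangentSpace 𝓘(ℝ, Cn n) x) :
    AffineConnection.canonical L C B r s Y x v =
      A.hopfConnection (-r + r * s) ((1 - r + r * s + s) / 2) ((1 - r + r * s - s) / 2) Y x v := by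
  rw [AffineConnection.canonical_apply, AffineConnection.gauduchon_apply, leviCivita_unique hL hY,
    chern_unique hC hY, bismut_unique hB hY]
  simp only [hopfConnection_apply]
  have h : ∀ d z v Y : Cn n,
      (1 - s) • (((1 + r) / 2) • (d + christoffel (-1) 0 0 z v Y) +
        ((1 - r) / 2) • (d + christoffel 1 1 1 z v Y)) + s • (d + christoffel 0 1 0 z v Y) =
      d + christoffel (-r + r * s) ((1 - r + r * s + s) / 2) ((1 - r + r * s - s) / 2) z v Y := by
    intro d z v Y
    have e := christoffel_affine ((1 - s) * ((1 + r) / 2)) ((1 - s) * ((1 - r) / 2)) s (by ring)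
      (-1) 0 0 1 1 1 0 1 0 z v Y
    rw [show (1 - s) * ((1 + r) / 2) * -1 + (1 - s) * ((1 - r) / 2) * 1 + s * 0 =
        -r + r * s by ring,
      show (1 - s) * ((1 + r) / 2) * 0 + (1 - s) * ((1 - r) / 2) * 1 + s * 1 =
        (1 - r + r * s + s) / 2 by ring,
      show (1 - s) * ((1 + r) / 2) * 0 + (1 - s) * ((1 - r) / 2) * 1 + s * 0 =
        (1 - r + r * s - s) / 2 by ring] at e
    rw [e]
    module
  exact h _ _ _ _

lemma diffFieldAt_hopfConnection_extend (x : A.HopfManifold) (v w : TangentSpace 𝓘(ℝ, Cn n) x) :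
    AffineConnection.DiffFieldAt (fun y => A.hopfConnection t m b (FiberBundle.extend (Cn n) w) y
        (FiberBundle.extend (Cn n) v y)) x := by
  obtain ⟨T, hT, -⟩ := hasFDerivAt_christoffel t m b (chart_ne (A := A) (x := x) (y := x)) v w
  exact diffFieldAt_iff_self.2 ((hasMFDerivAt_comp_chart hT).congr_of_eventuallyEq
    ((hopfConnection_extend t m b x w).mono fun y hy => hy v)).mdifferentiableAt

/-- A connection that agrees with a member of the family on differentiable vector fields has the
same curvature. -/
theorem curvature_congr
    (h : ∀ (x : A.HopfManifold) (Y : Π y : A.HopfManifold, TangentSpace 𝓘(ℝ, Cn n) y),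
      AffineConnection.DiffFieldAt Y x → ∀ v, D Y x v = A.hopfConnection t m b Y x v)
    (x : A.HopfManifold) (u v w : TangentSpace 𝓘(ℝ, Cn n) x) :
    D.curvature x u v w = curv t m b (chartAt (Cn n) x x) u v w := by
  have key : ∀ v u : TangentSpace 𝓘(ℝ, Cn n) x,
      D (fun y => D (FiberBundle.extend (Cn n) w) y (FiberBundle.extend (Cn n) v y)) x u =
      A.hopfConnection t m b (fun y => A.hopfConnection t m b (FiberBundle.extend (Cn n) w) y
        (FiberBundle.extend (Cn n) v y)) x u := by
    intro v u
    have hev : ∀ᶠ y in nhds x,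
        D (FiberBundle.extend (Cn n) w) y (FiberBundle.extend (Cn n) v y) =
        A.hopfConnection t m b (FiberBundle.extend (Cn n) w) y (FiberBundle.extend (Cn n) v y) := by
      filter_upwards [flatConnection_extend w] with y hy
      exact h y _ hy.1 _
    have hd' := diffFieldAt_hopfConnection_extend t m b x v w
    have hd : AffineConnection.DiffFieldAt
        (fun y => D (FiberBundle.extend (Cn n) w) y (FiberBundle.extend (Cn n) v y)) x :=
      diffFieldAt_iff_self.2 ((diffFieldAt_iff_self.1 hd').congr_of_eventuallyEq
        (hev.mono fun y hy => congrArg _ hy))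
    rw [h x _ hd]
    exact DFunLike.congr_fun (
      (A.hopfConnection t m b).isCovariantDerivativeOnUniv.congr_of_eventuallyEq hd hd'
        Filter.univ_mem hev) u
  rw [← curvature_hopfConnection]
  unfold AffineConnection.curvature AffineConnection.curvatureField
  rw [key, key, h x _ (diffFieldAt_extend x w)]

end HopfMultiplier

/-! ### Existence of adapted frames, and flatness -/

namespace HopfAlgebra
variable {n : ℕ} {z e : Cn n}

/-- Fewer than `n` vectors of `ℂⁿ` have a common nonzero orthogonal vector. -/
lemma exists_orthogonal (s : Finset (Cn n)) (hs : s.card < n) :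
    ∃ f : Cn n, f ≠ 0 ∧ ∀ v ∈ s, inner ℂ v f = (0 : ℂ) := by
  have h1 : Submodule.span ℂ (s : Set (Cn n)) ≠ ⊤ := fun h => by
    have h2 : Module.finrank ℂ (Submodule.span ℂ (s : Set (Cn n))) ≤ s.card :=
      finrank_span_finset_le_card s
    rw [h, finrank_top, finrank_euclideanSpace_fin] at h2
    omega
  have h2 : (Submodule.span ℂ (s : Set (Cn n)))ᗮ ≠ ⊥ := fun h =>
    h1 (Submodule.orthogonal_eq_bot_iff.1 h)
  obtain ⟨f, hf, hf0⟩ := Submodule.exists_mem_ne_zero_of_ne_bot h2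
  exact ⟨f, hf0, fun v hv => (Submodule.mem_orthogonal _ f).1 hf v (Submodule.subset_span hv)⟩

lemma IsFrame.of_orthogonal {f : Cn n} (hz : z ≠ 0) (hf : f ≠ 0) (h : inner ℂ z f = (0 : ℂ)) :
    IsFrame z (((‖z‖ / ‖f‖ : ℝ) : ℂ) • f) where
  pos := norm_pos_iff.2 hz
  orth := by rw [inner_smul_right, h, mul_zero]
  norm_eq := by
    have := norm_pos_iff.2 hf
    have := norm_pos_iff.2 hz
    rw [norm_smul, Complex.norm_real, Real.norm_of_nonneg (by positivity)]
    field_simp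

lemma exists_isFrame (hn : 2 ≤ n) (hz : z ≠ 0) : ∃ e, IsFrame z e := by
  obtain ⟨f, hf, h⟩ := exists_orthogonal {z} (by rw [Finset.card_singleton]; omega)
  exact ⟨_, IsFrame.of_orthogonal hz hf (h z (by simp))⟩

/-- Any vector `u` lies in the plane of some adapted frame: take for `e` the direction of the
component of `u` orthogonal to `z`. -/
lemma exists_isFrame_comb (hn : 2 ≤ n) (hz : z ≠ 0) (u : Cn n) :
    ∃ e x, IsFrame z e ∧ u = comb z e x := by
  have h0 : ((‖z‖ : ℂ)) ≠ 0 := by exact_mod_cast norm_ne_zero_iff.2 hz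
  set c : ℂ := inner ℂ z u / (‖z‖ : ℂ) ^ 2
  have horth : inner ℂ z (u - c • z) = (0 : ℂ) := by
    rw [inner_sub_right, inner_smul_right, inner_self_eq_norm_sq_to_K]
    change _ - inner ℂ z u / (‖z‖ : ℂ) ^ 2 * (‖z‖ : ℂ) ^ 2 = 0
    field_simp
    simp
  by_cases h : u - c • z = 0
  · obtain ⟨e, he⟩ := exists_isFrame hn hz
    exact ⟨e, (c, 0), he, by simpa [comb] using sub_eq_zero.1 h⟩
  · have h1 : ((‖u - c • z‖ : ℂ)) ≠ 0 := by exact_mod_cast norm_ne_zero_iff.2 h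
    refine ⟨_, (c, (‖u - c • z‖ / ‖z‖ : ℂ)), IsFrame.of_orthogonal hz h horth, ?_⟩
    simp only [comb, smul_smul]
    push_cast
    rw [show (‖u - c • z‖ / ‖z‖ * (‖z‖ / ‖u - c • z‖) : ℂ) = 1 by field_simp]
    module

lemma IsFrame.surjective_comb {z e : Cn 2} (h : IsFrame z e) (u : Cn 2) : ∃ x, u = comb z e x := by
  have hz : z ≠ 0 := norm_pos_iff.1 h.pos
  have he : e ≠ 0 := norm_pos_iff.1 (h.norm_eq ▸ h.pos)
  have hli : LinearIndependent ℂ ![z, e] := by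
    refine linearIndependent_of_ne_zero_of_inner_eq_zero (𝕜 := ℂ) ?_ ?_
    · intro i; fin_cases i <;> simpa
    · intro i j hij
      fin_cases i <;> fin_cases j <;> simp [h.orth, inner_eq_zero_symm.1 h.orth] at hij ⊢
  have hs := hli.span_eq_top_of_card_eq_finrank (by simp)
  have hu : u ∈ Submodule.span ℂ (Set.range ![z, e]) := hs ▸ Submodule.mem_top
  rw [Matrix.range_cons_cons_empty, Submodule.mem_span_pair] at hu
  obtain ⟨a, c, h⟩ := hu
  exact ⟨(a, c), h.symm⟩

lemma real_inner_comb (hf : IsFrame z e) (x y : ℂ × ℂ) :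
    inner ℝ (comb z e x) (comb z e y) = ‖z‖ ^ 2 * (herm x y).re := by
  rw [HopfMultiplier.real_inner, hf.inner_eq, Complex.re_ofReal_mul]

lemma I_smul_comb (x : ℂ × ℂ) : Complex.I • comb z e x = comb z e (Complex.I • x) :=
  (comb_smul _ _).symm

/-- The flat members of the family on the circle `m² + b² = 2`. The components of the curvature in
a frame leave three pairs `(m, b)`; for each of them `t ≠ 0`, and then the curvature does not vanish
on a vector orthogonal to the frame, so that `n = 2`. -/
lemma flat_parameters {t m b : ℝ} (hn : 2 ≤ n) (hz : z ≠ 0) (hmb : t = m + b - 1)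
    (hmb2 : m ^ 2 + b ^ 2 = 2) (h : ∀ u v w, curv t m b z u v w = 0) :
    n = 2 ∧ ((m = 1 ∧ b = 1) ∨ (m = 1 ∧ b = -1) ∨ (m = -1 ∧ b = 1)) := by
  obtain ⟨e, he⟩ := exists_isFrame hn hz
  have hcomb : ∀ c : ℂ, comb z e (c, 0) = 0 → c = 0 := fun c hc => by
    simpa [comb, hz] using hc
  have h1 : (m + b) * (1 - b) = 0 := by
    have := hcomb _ ((frameCurv_radial t m b hmb ▸ he.curv_eq t m b _ _ _).symm.trans (h _ _ _))
    exact_mod_cast (mul_eq_zero.1 this).resolve_right Complex.I_ne_zero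
  have h2 : (m + b) * (m - 1) = 0 := by
    have := hcomb _ ((frameCurv_radial_I t m b hmb ▸ he.curv_eq t m b _ _ _).symm.trans (h _ _ _))
    exact_mod_cast this
  have h3 : (m = 1 ∧ b = 1) ∨ (m = 1 ∧ b = -1) ∨ (m = -1 ∧ b = 1) := by
    rcases mul_eq_zero.1 h1 with h3 | h3
    · have hb : b = -m := by linarith
      subst hb
      have : (m - 1) * (m + 1) = 0 := by linarith
      rcases mul_eq_zero.1 this with h4 | h4
      · right; left; constructor <;> linarith
      · right; right; constructor <;> linarith
    · have hb : b = 1 := by linarith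
      subst hb
      rcases mul_eq_zero.1 h2 with h4 | h4
      · exact Or.inr (Or.inr ⟨by linarith, rfl⟩)
      · exact Or.inl ⟨by linarith, rfl⟩
  refine ⟨?_, h3⟩
  by_contra hn2
  obtain ⟨f, hf, hfo⟩ := exists_orthogonal {z, e} (Finset.card_le_two.trans_lt (by omega))
  have h4 := curv_orthogonal t m b he (hfo z (by simp)) (hfo e (by simp))
  rw [h] at h4
  have ht : t = 0 := by simpa [hf] using h4.symm
  rcases h3 with ⟨rfl, rfl⟩ | ⟨rfl, rfl⟩ | ⟨rfl, rfl⟩ <;> norm_num at hmb <;> linarith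

lemma curv_eq_zero_of_two {t m b : ℝ} {z : Cn 2} (hz : z ≠ 0)
    (h : ∀ u v w, frameCurv t m b u v w = 0) (u v w : Cn 2) : curv t m b z u v w = 0 := by
  obtain ⟨e, he⟩ := exists_isFrame le_rfl hz
  obtain ⟨x, rfl⟩ := he.surjective_comb u
  obtain ⟨y, rfl⟩ := he.surjective_comb v
  obtain ⟨w, rfl⟩ := he.surjective_comb w
  rw [he.curv_eq, h]
  simp [comb]

end HopfAlgebra

/-! ### The holomorphic sectional curvature -/

namespace HopfMultiplier
open HopfAlgebra

variable {n : ℕ} {A : HopfMultiplier n} {t m b : ℝ}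
  {D : AffineConnection 𝓘(ℝ, Cn n) A.HopfManifold}

/-- The holomorphic sectional curvature of the plane of `c₁ z + c₂ e` is a constant multiple of
`|c₂|² / (|c₁|² + |c₂|²)`: it is zero in the direction of `z` and extremal orthogonally
to it. -/
lemma sectionalCurvature_eq (hmb : t = m + b - 1)
    (hD : ∀ (x : A.HopfManifold) (u v w : TangentSpace 𝓘(ℝ, Cn n) x),
      D.curvature x u v w = curv t m b (chartAt (Cn n) x x) u v w)
    (x : A.HopfManifold) {e : Cn n} (he : IsFrame (chartAt (Cn n) x x) e) (c : ℂ × ℂ) :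
    D.sectionalCurvature A.metric x (comb (chartAt (Cn n) x x) e c)
      (A.complexStructure x (comb (chartAt (Cn n) x x) e c)) =
      (2 - m ^ 2 - b ^ 2) / 2 *
        (Complex.normSq c.2 / (Complex.normSq c.1 + Complex.normSq c.2)) := by
  have hz : ‖chartAt (Cn n) x x‖ ≠ 0 := he.pos.ne'
  have hexpand : ∀ u : TangentSpace 𝓘(ℝ, Cn n) x,
      D.sectionalCurvature A.metric x u (A.complexStructure x u) =
        (fun (z u : Cn n) => -(2 / ‖z‖ ^ 2 * inner ℝ (curv t m b z u (Complex.I • u) u)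
            (Complex.I • u)) /
          (2 / ‖z‖ ^ 2 * inner ℝ u u * (2 / ‖z‖ ^ 2 * inner ℝ (Complex.I • u) (Complex.I • u)) -
            (2 / ‖z‖ ^ 2 * inner ℝ u (Complex.I • u)) ^ 2)) (chartAt (Cn n) x x) u := by
    intro u
    unfold AffineConnection.sectionalCurvature AffineConnection.curvature4
    rw [hD]
    rfl
  refine (hexpand _).trans ?_
  dsimp only
  rw [I_smul_comb, he.curv_eq, real_inner_comb he, real_inner_comb he, real_inner_comb he,
    real_inner_comb he, herm_frameCurv_self t m b hmb]
  have h1 : (herm c c).re = Complex.normSq c.1 + Complex.normSq c.2 := by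
    simp [herm, Complex.normSq_apply]
  have h2 : (herm (Complex.I • c) (Complex.I • c)).re =
      Complex.normSq c.1 + Complex.normSq c.2 := by
    simp [herm, Complex.normSq_apply]
  have h3 : (herm c (Complex.I • c)).re = 0 := by
    simp [herm, mul_comm]
  rw [h1, h2, h3]
  generalize Complex.normSq c.1 + Complex.normSq c.2 = q
  rcases eq_or_ne q 0 with rfl | hq
  · simp
  field_simp
  ring

end HopfMultiplier

end

/-! ### Holomorphic sectional curvature and flatness of the canonical connections -/

open HopfAlgebra HopfMultiplier in
theorem proposition13 {n : ℕ} (hn : 2 ≤ n) (A : HopfMultiplier n) :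
    -- the three connections exist
    (∃ L C B : AffineConnection 𝓘(ℝ, Cn n) A.HopfManifold,
      L.IsLeviCivita A.metric ∧ C.IsChern A.metric A.complexStructure ∧
        B.IsBismut A.metric A.complexStructure) ∧
    -- the claim about them
    ∀ L C B : AffineConnection 𝓘(ℝ, Cn n) A.HopfManifold,
      L.IsLeviCivita A.metric → C.IsChern A.metric A.complexStructure →
      B.IsBismut A.metric A.complexStructure →
      (∀ r s : ℝ, (r, s) ∈ canonicalDomain \ chenNieCurve →
        ¬ ∃ c : ℝ, (AffineConnection.canonical L C B r s).HasConstantHSC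
            A.metric A.complexStructure c) ∧
      (∀ r s : ℝ, (r, s) ∈ chenNieCurve →
        (AffineConnection.canonical L C B r s).HasConstantHSC A.metric A.complexStructure 0) ∧
      (∀ r s : ℝ, (r, s) ∈ canonicalDomain →
        ((AffineConnection.canonical L C B r s).IsFlat ↔
          n = 2 ∧ ((r, s) = (-1, 0) ∨ (r, s) = (-1, 2) ∨ (r, s) = (1 / 3, -2)))) := by
  refine ⟨⟨_, _, _, hopfConnection_isLeviCivita, hopfConnection_isChern, hopfConnection_isBismut⟩,
    fun L C B hL hC hB => ?_⟩
  have hcurv : ∀ (r s : ℝ) (x : A.HopfManifold) (u v w : TangentSpace 𝓘(ℝ, Cn n) x),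
      (AffineConnection.canonical L C B r s).curvature x u v w =
        curv (-r + r * s) ((1 - r + r * s + s) / 2) ((1 - r + r * s - s) / 2)
          (chartAt (Cn n) x x) u v w := fun r s =>
    curvature_congr _ _ _ fun x Y hY v => canonical_eq hL hC hB r s hY v
  have hsec : ∀ (r s : ℝ) (x : A.HopfManifold) {e : Cn n}
      (he : IsFrame (chartAt (Cn n) x x) e) (c : ℂ × ℂ), _ := fun r s x e he c =>
    sectionalCurvature_eq (by ring) (hcurv r s) x he c
  -- in the parameters of `D^r_s`, the circle `m² + b² = 2` is `chenNieCurve`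
  have hΓ : ∀ r s : ℝ, 2 - ((1 - r + r * s + s) / 2) ^ 2 - ((1 - r + r * s - s) / 2) ^ 2 =
      (4 - ((1 - r + r * s) ^ 2 + s ^ 2)) / 2 := fun r s => by ring
  -- an arbitrary point, at which constancy is refuted
  have hpt : ∃ x : A.HopfManifold, ∃ e, IsFrame (chartAt (Cn n) x x) e := by
    obtain ⟨f, hf, -⟩ := exists_orthogonal (n := n) ∅ (by simp; omega)
    obtain ⟨e, he⟩ := exists_isFrame hn
      (chart_ne (A := A) (x := A.proj ⟨f, hf⟩) (y := A.proj ⟨f, hf⟩))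
    exact ⟨_, e, he⟩
  obtain ⟨x₀, e₀, he₀⟩ := hpt
  have hnc : ∀ r s : ℝ, ∀ c, (AffineConnection.canonical L C B r s).HasConstantHSC
      A.metric A.complexStructure c → (r, s) ∈ chenNieCurve := by
    intro r s c h
    -- compare the curvature along the position vector, which is zero, with the one orthogonal to it
    have hz0 : comb (chartAt (Cn n) x₀ x₀) e₀ (1, 0) ≠ 0 := by
      rw [comb_one_zero]; exact chart_ne
    have he0 : comb (chartAt (Cn n) x₀ x₀) e₀ (0, 1) ≠ 0 := by
      rw [comb_zero_one]; exact norm_pos_iff.1 (he₀.norm_eq ▸ he₀.pos)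
    have h1 := (hsec r s x₀ he₀ (1, 0)).symm.trans (h x₀ _ hz0)
    have h2 := (hsec r s x₀ he₀ (0, 1)).symm.trans (h x₀ _ he0)
    rw [hΓ] at h1 h2
    simp at h1 h2
    change (1 - r + r * s) ^ 2 + s ^ 2 = 4
    linarith
  refine ⟨fun r s hrs ⟨c, hc⟩ => hrs.2 (hnc r s c hc), fun r s hrs x u hu => ?_,
    fun r s hrs => ⟨fun h => ?_, ?_⟩⟩
  · obtain ⟨e, c, he, rfl⟩ := exists_isFrame_comb hn (chart_ne (A := A) (x := x) (y := x)) u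
    have hrs' : (1 - r + r * s) ^ 2 + s ^ 2 = 4 := hrs
    refine (hsec r s x he c).trans ?_
    rw [hΓ, hrs']
    simp
  · have hrs : (1 - r + r * s) ^ 2 + s ^ 2 = 4 := hnc r s 0 fun x u _ => by
      unfold AffineConnection.sectionalCurvature AffineConnection.curvature4
      rw [h x u]
      simp
    obtain ⟨h2, h3⟩ := flat_parameters hn (chart_ne (A := A) (x := x₀) (y := x₀))
      (t := -r + r * s) (m := (1 - r + r * s + s) / 2) (b := (1 - r + r * s - s) / 2) (by ring)
      (by linarith [hΓ r s]) (fun u v w => (hcurv r s x₀ u v w).symm.trans (h x₀ u v w))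
    refine ⟨h2, ?_⟩
    simp only [Prod.mk.injEq]
    rcases h3 with ⟨h4, h5⟩ | ⟨h4, h5⟩ | ⟨h4, h5⟩
    · have hs : s = 0 := by linarith
      subst hs
      left; constructor <;> linarith
    · have hs : s = 2 := by linarith
      subst hs
      right; left; constructor <;> linarith
    · have hs : s = -2 := by linarith
      subst hs
      right; right; constructor <;> linarith
  · rintro ⟨rfl, h⟩ x u v w
    rw [hcurv]
    refine curv_eq_zero_of_two chart_ne ?_ u v w
    simp only [Prod.mk.injEq] at h
    rcases h with ⟨rfl, rfl⟩ | ⟨rfl, rfl⟩ | ⟨rfl, rfl⟩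
    · norm_num only; exact fun u v w => frameCurv_one_one u v w
    · norm_num only; exact fun u v w => frameCurv_one_neg_one u v w
    · norm_num only; exact fun u v w => frameCurv_neg_one_one u v w
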